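/- Conventions. $\mathcal F$ is the set of non-empty finite subsets of $\mathbb N$; for $\alpha,\beta\in\mathcal F$, $\alpha<\beta$ means $\max\alpha<\min\beta$. $\mathbb N^{(m)}$ is the family of $m$-element subsets of $\mathbb N$. Let $G$ be a countable (discrete) abelian group. A sequence $(g_k)_{k\in\mathbb N}$ in $G$ tends to infinity, $\lim_{k\to\infty}g_k=\infty$, if it leaves every finite subset of $G$ eventually. For a sequence $(g_k)_{k\in\mathbb N}$ in $G$ and $\alpha\in\mathcal F$ put $g_\alpha=\sum_{k\in\alpha}g_k$. For $(x_\alpha)_{\alpha\in\mathcal F}$ in $G$ we write $\lim_{\alpha\to\infty}x_\alpha=\infty$ if for every finite $K\subseteq G$ there is $\alpha_0\in\mathcal F$ with $x_\alpha\notin K$ for all $\alpha\in\mathcal F$, $\alpha>\alpha_0$. For a sequence $(\mathbf g_k)_{k\in\mathbb N}=(g_{k,1},\dots,g_{k,m})_{k\in\mathbb N}$ in $G^m$ and $\alpha=\{k_1<\dots<k_m\}\in\mathbb N^{(m)}$ put $g_\alpha=g_{k_1,1}+\dots+g_{k_m,m}$. A sequence $(\mathbf g_k)$ in $G^m$ is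 *non-degenerated* if $\lim_{k\to\infty}g_{k,t}=\infty$ for every $t\in\{1,\dots,m\}$; two sequences $(\mathbf g_k),(\mathbf h_k)$ in $G^m$ are *essentially distinct* if $\lim_{k\to\infty}(g_{k,t}-h_{k,t})=\infty$ for every $t$ (for several sequences: pairwise). A set $E\subseteq G^\ell$ is an $\widetilde{\mathrm{IP}}$ set if $E=\{(g^{(1)}_\alpha,\dots,g^{(\ell)}_\alpha)\,|\,\alpha\in\mathcal F\}$ for some sequences $(g^{(j)}_k)_{k\in\mathbb N}$ in $G$, $j\in\{1,\dots,\ell\}$, with $$\lim_{\alpha\to\infty}g^{(j)}_\alpha=\infty\ \text{ for all } j,\qquad \lim_{\alpha\to\infty}(g^{(j)}_\alpha-g^{(i)}_\alpha)=\infty\ \text{ for all } i\ne j;\qquad(\ast)$$ it is an $\widetilde{\mathrm{IP}}{}^*$ set if it meets every $\widetilde{\mathrm{IP}}$ set in $G^\ell$. An *IP-ring* is a set $\mathcal F^{(1)}=\{\bigcup_{j\in\alpha}\alpha_j\,|\,\alpha\in\mathcal F\}$, where $\alpha_k\in\mathcal F$ and $\alpha_k<\alpha_{k+1}$ for all $k\in\mathbb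 N$. For $x_\alpha,x$ in a metric space $(Y,d)$: $\mathop{\mathrm{IP\text{-}lim}}_{\alpha\in\mathcal F^{(1)}}x_\alpha=x$ means that for every $\epsilon>0$ there is $\alpha_0\in\mathcal F^{(1)}$ with $d(x_\alpha,x)<\epsilon$ for all $\alpha\in\mathcal F^{(1)}$, $\alpha>\alpha_0$; and $\mathop{\mathcal R\text{-}\lim}_{\alpha\in\mathbb N^{(m)}}x_\alpha=x$ means that for every $\epsilon>0$ there is $\alpha_0\in\mathbb N^{(m)}$ with $d(x_\alpha,x)<\epsilon$ for all $\alpha\in\mathbb N^{(m)}$ with $\min\alpha>\max\alpha_0$. Let $(T_g)_{g\in G}$ be a measure preserving action of $G$ on a separable probability space $(X,\mathcal A,\mu)$. A sequence $(S_k)_{k\in\mathbb N}$ of measure preserving transformations of $X$ has the *mixing property* if $\lim_{k\to\infty}\mu(A_0\cap S_k^{-1}A_1)=\mu(A_0)\mu(A_1)$ for all $A_0,A_1\in\mathcal A$. The action is *mildly mixing* if for any sequence $(g_k)_{k\in\mathbb N}$ in $G$ with $\lim_{\alpha\to\infty}g_\alpha=\infty$ there is an IP-ring $\mathcal F^{(1)}$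 such that for every $f\in L^2(\mu)$, $\mathop{\mathrm{IP\text{-}lim}}_{\alpha\in\mathcal F^{(1)}}f\circ T_{g_\alpha}=\int_Xf\,d\mu$ weakly in $L^2(\mu)$. **Theorem.** Let $\ell\in\mathbb N=\{1,2,\dots\}$, let $G$ be a countable abelian group and let $(T_g)_{g\in G}$ be a measure preserving action of $G$ on a separable probability space $(X,\mathcal A,\mu)$. The following statements are equivalent: (i) $(T_g)_{g\in G}$ is mildly mixing. (ii) For any $\widetilde{\mathrm{IP}}$ set $E\subseteq G^\ell$ and any $m\in\mathbb N$ there exist non-degenerated and (pairwise) essentially distinct sequences $(\mathbf g^{(j)}_k)_{k\in\mathbb N}=(g^{(j)}_{k,1},\dots,g^{(j)}_{k,m})_{k\in\mathbb N}$, $j\in\{1,\dots,\ell\}$, in $G^m$ such that: (a) $\{(g^{(1)}_\alpha,\dots,g^{(\ell)}_\alpha)\,|\,\alpha\in\mathbb N^{(m)}\}\subseteq E$; (b) for any $t\in\{1,\dots,m\}$ and any $j\in\{1,\dots,\ell\}$, $(T_{g^{(j)}_{k,t}})_{k\in\mathbb N}$ has the mixing property; (c) for any $t\in\{1,\dots,m\}$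 and any $i\ne j$ in $\{1,\dots,\ell\}$, $(T_{g^{(j)}_{k,t}-g^{(i)}_{k,t}})_{k\in\mathbb N}$ has the mixing property. (iii) For any $\widetilde{\mathrm{IP}}$ set $E\subseteq G^\ell$ there exist $m\in\mathbb N$ and non-degenerated and (pairwise) essentially distinct sequences $(\mathbf g^{(1)}_k)_{k\in\mathbb N},\dots,(\mathbf g^{(\ell)}_k)_{k\in\mathbb N}$ in $G^m$ with $\{(g^{(1)}_\alpha,\dots,g^{(\ell)}_\alpha)\,|\,\alpha\in\mathbb N^{(m)}\}\subseteq E$ such that for all $A_0,\dots,A_\ell\in\mathcal A$, $$\mathop{\mathcal R\text{-}\lim}_{\alpha\in\mathbb N^{(m)}}\mu(A_0\cap T_{g^{(1)}_\alpha}A_1\cap\dots\cap T_{g^{(\ell)}_\alpha}A_\ell)=\prod_{j=0}^\ell\mu(A_j).$$ (iv) For any sequences $(g^{(1)}_k)_{k\in\mathbb N},\dots,(g^{(\ell)}_k)_{k\in\mathbb N}$ in $G$ satisfying $(\ast)$ there exists an IP-ring $\mathcal F^{(1)}$ such that for all $A_0,\dots,A_\ell\in\mathcal A$, $$\mathop{\mathrm{IP\text{-}lim}}_{\alpha\in\mathcal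 F^{(1)}}\mu(A_0\cap T_{g^{(1)}_\alpha}A_1\cap\dots\cap T_{g^{(\ell)}_\alpha}A_\ell)=\prod_{j=0}^\ell\mu(A_j).$$ (v) For all $A_0,\dots,A_\ell\in\mathcal A$ and all $\epsilon>0$, the set $$R_\epsilon(A_0,\dots,A_\ell)=\Big\{(g_1,\dots,g_\ell)\in G^\ell\ \Big|\ \Big|\mu(A_0\cap T_{g_1}A_1\cap\dots\cap T_{g_\ell}A_\ell)-\prod_{j=0}^\ell\mu(A_j)\Big|<\epsilon\Big\}$$ is an $\widetilde{\mathrm{IP}}{}^*$ set. -/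

import Mathlib

open MeasureTheory Filter Topology
open scoped Pointwise

namespace MildMixing

/-- For non-empty finite `α β ⊆ ℕ`, the relation `α < β`, i.e. `max α < min β`. -/
def Before (α β : Finset ℕ) : Prop := ∀ a ∈ α, ∀ b ∈ β, a < b

/-! ### `𝓕`-sequences, IP-rings and IP-limits

`𝓕` is the set of all non-empty finite subsets of `ℕ`; an `𝓕`-sequence is represented by a function
on `Finset ℕ`, of which only the values at non-empty sets are ever used. -/

section IP

variable {G : Type*} [AddCommGroup G]

/-- `g_α = ∑_{k ∈ α} g_k`. -/
def ipSum (g : ℕ → G) (α : Finset ℕ) : G := ∑ k ∈ α, g k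

/-- `lim_{α → ∞} x_α = ∞` for an `𝓕`-sequence: for every finite `K` there is `α₀ ∈ 𝓕` such that
`x_α ∉ K` for every `α ∈ 𝓕` with `α > α₀`. -/
def IPTendstoInfty (x : Finset ℕ → G) : Prop :=
  ∀ K : Finset G, ∃ α₀ : Finset ℕ, α₀.Nonempty ∧
    ∀ α : Finset ℕ, α.Nonempty → Before α₀ α → x α ∉ K

/-- The sequences `g^{(1)}, …, g^{(d)}` in `G` satisfy `lim_{α → ∞} g^{(j)}_α = ∞` for every `j`
and `lim_{α → ∞} (g^{(j)}_α - g^{(i)}_α) = ∞` for all `i ≠ j`. -/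
def IsIPTildeGenerator {d : ℕ} (g : Fin d → ℕ → G) : Prop :=
  (∀ j, IPTendstoInfty (ipSum (g j))) ∧
    ∀ i j, i ≠ j → IPTendstoInfty (fun α => ipSum (g j) α - ipSum (g i) α)

/-- `E ⊆ G^d` is an `ĨP` set. -/
def IsIPTilde {d : ℕ} (E : Set (Fin d → G)) : Prop :=
  ∃ g : Fin d → ℕ → G, IsIPTildeGenerator g ∧
    E = {v | ∃ α : Finset ℕ, α.Nonempty ∧ v = fun j => ipSum (g j) α}

/-- `E ⊆ G^d` is an `ĨP^*` set: it meets every `ĨP` set in `G^d`. -/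
def IsIPTildeStar {d : ℕ} (E : Set (Fin d → G)) : Prop :=
  ∀ D : Set (Fin d → G), IsIPTilde D → (E ∩ D).Nonempty

end IP

/-- An IP-ring: the family of all `⋃_{j ∈ α} α_j`, `α ∈ 𝓕`, for some sequence
`α_0 < α_1 < ⋯` in `𝓕`. -/
def IsIPRing (R : Set (Finset ℕ)) : Prop :=
  ∃ a : ℕ → Finset ℕ, (∀ k, (a k).Nonempty) ∧ (∀ k, Before (a k) (a (k + 1))) ∧
    R = {β | ∃ α : Finset ℕ, α.Nonempty ∧ β = α.biUnion a}

/-- `IP-lim_{α ∈ R} x_α = y`. -/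
def IPLim {Y : Type*} [PseudoMetricSpace Y] (R : Set (Finset ℕ)) (x : Finset ℕ → Y) (y : Y) :
    Prop :=
  ∀ ε > 0, ∃ α₀ ∈ R, ∀ α ∈ R, Before α₀ α → dist (x α) y < ε

/-! ### `ℕ^{(m)}`-sequences and `𝓡`-limits -/

/-- `ℕ^{(m)}`, the family of `m`-element subsets of `ℕ`. -/
abbrev MSubsets (m : ℕ) : Type := {α : Finset ℕ // α.card = m}

/-- `𝓡-lim_{α ∈ S^{(m)}} x_α = y`. -/
def RLim {Y : Type*} [PseudoMetricSpace Y] {m : ℕ} (S : Set ℕ) (x : MSubsets m → Y) (y : Y) :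
    Prop :=
  ∀ ε > 0, ∃ α₀ : MSubsets m, ∀ α : MSubsets m, (α.1 : Set ℕ) ⊆ S → Before α₀.1 α.1 →
    dist (x α) y < ε

section Sigma

variable {G : Type*} [AddCommGroup G] {m : ℕ}

/-- For a sequence `(g_{k,1}, …, g_{k,m})_k` in `G^m` and `α = {k_1 < ⋯ < k_m}`,
`g_α = g_{k_1,1} + ⋯ + g_{k_m,m}`. -/
def sigmaSum (g : ℕ → Fin m → G) (α : MSubsets m) : G :=
  ∑ t : Fin m, g (α.1.orderEmbOfFin α.2 t) t

/-- A non-degenerated sequence in `G^m`: each coordinate tends to infinity in the discrete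
group `G`. -/
def NonDegenerated (g : ℕ → Fin m → G) : Prop :=
  ∀ t, Tendsto (fun k => g k t) atTop cofinite

/-- Two sequences in `G^m` are essentially distinct: in each coordinate they grow apart. -/
def EssentiallyDistinct (g h : ℕ → Fin m → G) : Prop :=
  ∀ t, Tendsto (fun k => g k t - h k t) atTop cofinite

end Sigma

/-! ### Measure preserving systems

The action `(T_g)` is a Mathlib `AddAction`, `T_g x = g +ᵥ x`, and `T_g A = g +ᵥ A` for sets. -/

section System

variable {X : Type*} [MeasurableSpace X]

/-- The mixing property of a sequence of transformations. -/
def HasMixingProperty (T : ℕ → X → X) (μ : Measure X) : Prop :=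
  ∀ A₀ A₁ : Set X, MeasurableSet A₀ → MeasurableSet A₁ →
    Tendsto (fun k => μ.real (A₀ ∩ T k ⁻¹' A₁)) atTop (𝓝 (μ.real A₀ * μ.real A₁))

variable {G : Type*} [AddCommGroup G] [AddAction G X]

variable (G) in
/-- Mild mixing: whenever `lim_{α → ∞} g_α = ∞`, there is an IP-ring along which
`T_{g_α} f = f ∘ T_{g_α}` converges weakly in `L²(μ)` to the constant `∫ f dμ`,
for every `f ∈ L²(μ)`. -/
def IsMildlyMixing (μ : Measure X) : Prop :=
  ∀ g : ℕ → G, IPTendstoInfty (ipSum g) →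
    ∃ R : Set (Finset ℕ), IsIPRing R ∧
      ∀ f : X → ℂ, MemLp f 2 μ → ∀ h : X → ℂ, MemLp h 2 μ →
        IPLim R (fun α => ∫ x, f (ipSum g α +ᵥ x) * (starRingEnd ℂ) (h x) ∂μ)
          (∫ x, (∫ y, f y ∂μ) * (starRingEnd ℂ) (h x) ∂μ)

/-- `μ(A_0 ∩ T_{g_1} A_1 ∩ ⋯ ∩ T_{g_ℓ} A_ℓ)`. -/
noncomputable def multiCorr (μ : Measure X) {ℓ : ℕ} (A : Fin (ℓ + 1) → Set X) (g : Fin ℓ → G) :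
    ℝ :=
  μ.real (A 0 ∩ ⋂ j : Fin ℓ, (g j +ᵥ A j.succ))

variable (G) in
/-- `R_ε(A_0, …, A_ℓ) ⊆ G^ℓ`. -/
def returnSet (μ : Measure X) {ℓ : ℕ} (ε : ℝ) (A : Fin (ℓ + 1) → Set X) : Set (Fin ℓ → G) :=
  {g | |multiCorr μ A g - ∏ j, μ.real (A j)| < ε}

end System

end MildMixing

/-! Everything is read along one ultrafilter p on finite sets, idempotent under union and
concentrated on tails. By `galvin_glazer`, a p-large set contains an IP-ring. This gives two
transfers. Countably many p-limits hold along a common IP-ring (`IsUnionIdempotent.exists_ring`).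
Conversely, if every IP-system tending to infinity has a value of φ near y, then φ has p-limit y
along each such system (`tendsto_of_forall_exists`), because a bad p-large set would contain a whole
bad ring.

Multiple mixing is proved by induction on ℓ with a van der Corput lemma: a bounded family x_α tends
weakly to 0 along p when the p-limit in α of ⟨x_{β∪α}, x_α⟩ exists for each β and tends to 0 along p
in β. For products of translates minus the product of the integrals, invariance removes one
translation, the inductive hypothesis applies to the differences g^{(j)} - g^{(0)}, and mild mixing
of each single g^{(j)} makes the remaining expression vanish. A countable dense family of sets then
gives one ring for all sets, which is (iv).

The way back passes through `IsIPRecurrentlyMixing`, which asks for a single good time per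
IP-system, pair of sets and ε. The two transfers upgrade it to mild mixing. Both (ii) and (v) imply
it, since any IP-system tending to infinity contains the first coordinate of an ĨP set. The cycle is
(i) → (iv) → (iii) → (v) → (i), together with (i) ↔ (ii). -/

namespace MildMixing

/-! ### Idempotent ultrafilters on finite sets and the Galvin–Glazer argument -/

/-- `Finset ℕ` as a semigroup under union. -/
def UnionSemigroup : Type := Finset ℕ

instance : Semigroup UnionSemigroup where
  mul α β := (Finset.instUnion.union (α : Finset ℕ) (β : Finset ℕ) : Finset ℕ)
  mul_assoc α β γ := Finset.union_assoc (α : Finset ℕ) β γ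

/-- An ultrafilter on `Finset ℕ` is union-idempotent when it is idempotent for the operation induced
by `∪` and contains every set `{α | α ≠ ∅, min α ≥ n}`. -/
structure IsUnionIdempotent (p : Ultrafilter (Finset ℕ)) : Prop where
  tail : ∀ n : ℕ, ∀ᶠ α in (p : Filter (Finset ℕ)), α.Nonempty ∧ ∀ i ∈ α, n ≤ i
  idem : ∀ S : Set (Finset ℕ), (∀ᶠ α in (p : Filter (Finset ℕ)), α ∈ S) →
    ∀ᶠ α in (p : Filter (Finset ℕ)), ∀ᶠ β in (p : Filter (Finset ℕ)), α ∪ β ∈ S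

/-- The ultrafilters containing all tails form a non-empty compact subsemigroup with one-sidedly
continuous multiplication, so the Ellis–Numakura lemma applies. -/
theorem exists_isUnionIdempotent : ∃ p : Ultrafilter (Finset ℕ), IsUnionIdempotent p := by
  let t : ℕ → Set UnionSemigroup :=
    fun n => {α : Finset ℕ | α.Nonempty ∧ ∀ i ∈ α, n ≤ i}
  let : Semigroup (Ultrafilter UnionSemigroup) := Ultrafilter.semigroup
  have hanti : Antitone t := fun m n hmn α hα => ⟨hα.1, fun i hi => hmn.trans (hα.2 i hi)⟩
  have hne : ∀ n, (t n).Nonempty := fun n => ⟨({n} : Finset ℕ), by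
    refine ⟨Finset.singleton_nonempty n, fun i hi => ?_⟩
    rw [Finset.mem_singleton] at hi
    exact hi.ge⟩
  let N : Set (Ultrafilter UnionSemigroup) := {U | ∀ n, t n ∈ U}
  have hN1 : N.Nonempty := by
    have : NeBot (⨅ n, 𝓟 (t n)) := by
      refine iInf_neBot_of_directed' ?_ fun n => principal_neBot_iff.2 (hne n)
      exact (directed_of_isDirected_le fun m n hmn => principal_mono.2 (hanti hmn))
    refine ⟨Ultrafilter.of (⨅ n, 𝓟 (t n)), fun n => ?_⟩
    exact Ultrafilter.of_le _ (mem_iInf_of_mem n (mem_principal_self _))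
  have hN2 : IsCompact N := by
    refine IsClosed.isCompact ?_
    have : N = ⋂ n, {U : Ultrafilter UnionSemigroup | t n ∈ U} := by ext; simp [N]
    rw [this]
    exact isClosed_iInter fun n => ultrafilter_isClosed_basic (t n)
  have hN3 : ∀ᵉ (U ∈ N) (V ∈ N), U * V ∈ N := by
    intro U hU V hV n
    refine (Ultrafilter.eventually_mul U V (· ∈ t n)).2 ?_
    filter_upwards [hU n] with α hα
    filter_upwards [hV n] with β hβ
    refine ⟨hα.1.mono Finset.subset_union_left, fun i hi => ?_⟩
    rcases Finset.mem_union.1 hi with h | h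
    exacts [hα.2 i h, hβ.2 i h]
  obtain ⟨U, hU, hUU⟩ := exists_idempotent_in_compact_subsemigroup
    (M := Ultrafilter UnionSemigroup) (fun V => Ultrafilter.continuous_mul_left V) N hN1 hN2 hN3
  refine ⟨U, fun n => hU n, fun S hS => ?_⟩
  have h : ∀ᶠ α in (↑(U * U) : Filter UnionSemigroup), α ∈ (S : Set (Finset ℕ)) := by
    rw [hUU]; exact hS
  exact (Ultrafilter.eventually_mul U U _).1 h

/-- `a_0 < a_1 < ⋯` is a sequence of non-empty finite sets, i.e. it generates an IP-ring. -/
structure IsRingBase (a : ℕ → Finset ℕ) : Prop where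
  nonempty : ∀ k, (a k).Nonempty
  before : ∀ k, Before (a k) (a (k + 1))

namespace IsRingBase

variable {a : ℕ → Finset ℕ} (ha : IsRingBase a)
include ha

theorem before_of_lt {k l : ℕ} (h : k < l) : Before (a k) (a l) := by
  induction l, h using Nat.le_induction with
  | base => exact ha.before k
  | succ l _ ih =>
    intro x hx y hy
    obtain ⟨z, hz⟩ := ha.nonempty l
    exact (ih x hx z hz).trans (ha.before l z hz y hy)

theorem le_of_mem {k i : ℕ} (hi : i ∈ a k) : k ≤ i := by
  induction k generalizing i with
  | zero => exact Nat.zero_le i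
  | succ k ih =>
    obtain ⟨z, hz⟩ := ha.nonempty k
    exact (Nat.succ_le_succ (ih hz)).trans (ha.before k z hz i hi)

theorem disjoint {k l : ℕ} (h : k ≠ l) : Disjoint (a k) (a l) := by
  rw [Finset.disjoint_left]
  intro x hk hl
  rcases lt_or_gt_of_ne h with h | h
  · exact lt_irrefl x (ha.before_of_lt h x hk x hl)
  · exact lt_irrefl x (ha.before_of_lt h x hl x hk)

theorem biUnion_nonempty {α : Finset ℕ} (h : α.Nonempty) : (α.biUnion a).Nonempty :=
  h.biUnion fun k _ => ha.nonempty k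

theorem ipSum_biUnion {G : Type*} [AddCommGroup G] (g : ℕ → G) (α : Finset ℕ) :
    ipSum g (α.biUnion a) = ipSum (fun k => ipSum g (a k)) α :=
  Finset.sum_biUnion fun _ _ _ _ h => ha.disjoint h

theorem ipTendstoInfty {G : Type*} [AddCommGroup G] {g : ℕ → G}
    (hg : IPTendstoInfty (ipSum g)) : IPTendstoInfty (ipSum fun k => ipSum g (a k)) := by
  intro K
  obtain ⟨α₀, h0, h⟩ := hg K
  refine ⟨{α₀.sup id}, Finset.singleton_nonempty _, fun α hα hb => ?_⟩
  rw [← ha.ipSum_biUnion]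
  refine h _ (ha.biUnion_nonempty hα) fun x hx y hy => ?_
  obtain ⟨k, hk, hy⟩ := Finset.mem_biUnion.1 hy
  exact ((Finset.le_sup (f := id) hx).trans_lt
    (hb _ (Finset.mem_singleton_self _) k hk)).trans_le (ha.le_of_mem hy)

end IsRingBase

/-- Idempotence makes `star D` large and stable: each of its members can be extended within `star D`
by p-most sets. The a_k can thus be chosen one at a time without losing later unions. `T` is a
diagonal condition: it may depend on the a_k already chosen and binds all later unions. -/
theorem galvin_glazer {p : Ultrafilter (Finset ℕ)} (hp : IsUnionIdempotent p)
    {S : Set (Finset ℕ)} (hS : S ∈ p) {T : Finset ℕ → Set (Finset ℕ)} (hT : ∀ β, T β ∈ p) :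
    ∃ a : ℕ → Finset ℕ, IsRingBase a ∧ (∀ α : Finset ℕ, α.Nonempty → α.biUnion a ∈ S) ∧
      ∀ k, ∀ α : Finset ℕ, α.Nonempty → (∀ i ∈ α, k < i) → α.biUnion a ∈ T (a k) := by
  let star : Set (Finset ℕ) → Set (Finset ℕ) := fun D =>
    {α | α ∈ D ∧ ∀ᶠ β in (p : Filter (Finset ℕ)), α ∪ β ∈ D}
  let State := {D : Set (Finset ℕ) // D ∈ p ∧
    ∀ α ∈ D, ∀ᶠ β in (p : Filter (Finset ℕ)), α ∪ β ∈ D}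
  have hstar : ∀ D ∈ p, star D ∈ p ∧
      ∀ α ∈ star D, ∀ᶠ β in (p : Filter (Finset ℕ)), α ∪ β ∈ star D := by
    intro D hD
    refine ⟨inter_mem hD (hp.idem D hD), fun α hα => ?_⟩
    filter_upwards [hα.2, hp.idem {β | α ∪ β ∈ D} hα.2] with β h1 h2
    refine ⟨h1, ?_⟩
    filter_upwards [h2] with γ hγ
    rw [Finset.union_assoc]
    exact hγ
  have hpick : ∀ D : State, ∃ α : Finset ℕ, α ∈ D.1 ∧ α.Nonempty := fun D =>
    (nonempty_of_mem (inter_mem D.2.1 (hp.tail 0) : _ ∈ (p : Filter (Finset ℕ)))).imp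
      fun α h => ⟨h.1, h.2.1⟩
  choose pick hpick using hpick
  let next : State → Set (Finset ℕ) := fun D =>
    {β | β ∈ D.1 ∧ pick D ∪ β ∈ D.1 ∧ β ∈ T (pick D) ∧ Before (pick D) β}
  have hnext : ∀ D, next D ∈ p := by
    intro D
    filter_upwards [D.2.1, D.2.2 _ (hpick D).1, hT (pick D),
      hp.tail ((pick D).sup id + 1)] with β h1 h2 h3 h4
    exact ⟨h1, h2, h3, fun x hx y hy =>
      Nat.lt_of_succ_le ((Nat.succ_le_succ (Finset.le_sup (f := id) hx)).trans (h4.2 y hy))⟩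
  -- `D n` is the reservoir that will contain every union of sets a_k with k ≥ n.
  let D : ℕ → State := fun n =>
    Nat.rec ⟨star S, hstar S hS⟩ (fun _ D => ⟨star (next D), hstar _ (hnext D)⟩) n
  have hsub : ∀ n, (D (n + 1)).1 ⊆ next (D n) := fun n α hα => hα.1
  have hanti : Antitone fun n => (D n).1 :=
    antitone_nat_of_succ_le fun n α hα => (hsub n hα).1
  let a : ℕ → Finset ℕ := fun n => pick (D n)
  -- Peel off the smallest index k: the rest lies in `D (k + 1)`, hence in `next (D k)`, whose
  -- members may be joined to a_k.
  have key : ∀ α : Finset ℕ, ∀ n, α.Nonempty → (∀ i ∈ α, n ≤ i) → α.biUnion a ∈ (D n).1 := by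
    intro α
    induction α using Finset.induction_on_min with
    | empty => exact fun n h => absurd h Finset.not_nonempty_empty
    | insert k α hk ih =>
      intro n _ hn
      refine hanti (hn k (Finset.mem_insert_self _ _)) ?_
      rw [Finset.biUnion_insert]
      rcases α.eq_empty_or_nonempty with rfl | hα
      · simpa using (hpick (D k)).1
      · exact (hsub k (ih (k + 1) hα hk)).2.1
  refine ⟨a, ⟨fun k => (hpick (D k)).2, fun k => ?_⟩, fun α hα => ?_, fun k α hα h => ?_⟩
  · exact (hsub k (hpick (D (k + 1))).1).2.2.2
  · exact (key α 0 hα fun i _ => Nat.zero_le i).1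
  · exact (hsub k (key α (k + 1) hα h)).2.2.1

/-! ### Limits along IP-rings -/

/-- The filter of tails of the IP-ring generated by `a`. -/
def ringFilter (a : ℕ → Finset ℕ) : Filter (Finset ℕ) :=
  ⨅ n : ℕ, 𝓟 {β | ∃ α : Finset ℕ, α.Nonempty ∧ (∀ i ∈ α, n ≤ i) ∧ β = α.biUnion a}

theorem ringFilter_hasBasis (a : ℕ → Finset ℕ) : (ringFilter a).HasBasis (fun _ : ℕ => True)
    fun n => {β | ∃ α : Finset ℕ, α.Nonempty ∧ (∀ i ∈ α, n ≤ i) ∧ β = α.biUnion a} :=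
  hasBasis_iInf_principal (directed_of_isDirected_le fun _ _ hmn _ ⟨α, h0, h, e⟩ =>
    ⟨α, h0, fun i hi => hmn.trans (h i hi), e⟩)

theorem tendsto_ringFilter (a : ℕ → Finset ℕ) : Tendsto a atTop (ringFilter a) := by
  refine (ringFilter_hasBasis a).tendsto_right_iff.2 fun n _ => ?_
  filter_upwards [eventually_ge_atTop n] with k hk
  exact ⟨{k}, Finset.singleton_nonempty k, by simpa using hk, by simp⟩

/-- The IP-ring generated by `a`. -/
def ringOf (a : ℕ → Finset ℕ) : Set (Finset ℕ) :=
  {β | ∃ α : Finset ℕ, α.Nonempty ∧ β = α.biUnion a}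

namespace IsRingBase

variable {a : ℕ → Finset ℕ} (ha : IsRingBase a)
include ha

theorem isIPRing : IsIPRing (ringOf a) := ⟨a, ha.nonempty, ha.before, rfl⟩

theorem exists_mem_ring_before (α₀ : Finset ℕ) :
    ∃ n, ∀ α : Finset ℕ, α.Nonempty → (∀ i ∈ α, n ≤ i) → Before α₀ (α.biUnion a) := by
  refine ⟨α₀.sup id + 1, fun α _ h x hx y hy => ?_⟩
  obtain ⟨k, hk, hy⟩ := Finset.mem_biUnion.1 hy
  have := Finset.le_sup (f := id) hx
  have h2 := h k hk
  have h3 := ha.le_of_mem hy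
  simp only [id] at this
  omega

/-- Tails by index and tails by `Before` are cofinal in each other: elements of a_k are at least k,
and a union lying after a_n uses only indices at least n. -/
theorem ipLim_iff {Y : Type*} [PseudoMetricSpace Y] {x : Finset ℕ → Y} {y : Y} :
    IPLim (ringOf a) x y ↔ Tendsto x (ringFilter a) (𝓝 y) := by
  rw [(ringFilter_hasBasis a).tendsto_iff Metric.nhds_basis_ball]
  refine forall₂_congr fun ε _ => ⟨?_, ?_⟩
  · rintro ⟨α₀, _, h⟩
    obtain ⟨n, hn⟩ := ha.exists_mem_ring_before α₀
    refine ⟨n, trivial, ?_⟩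
    rintro _ ⟨α, h0, h1, rfl⟩
    exact h _ ⟨α, h0, rfl⟩ (hn α h0 h1)
  · rintro ⟨n, _, h⟩
    refine ⟨a n, ⟨{n}, Finset.singleton_nonempty n, by simp⟩, ?_⟩
    rintro _ ⟨α, h0, rfl⟩ hb
    refine h _ ⟨α, h0, fun i hi => ?_, rfl⟩
    by_contra! hlt
    obtain ⟨x, hx⟩ := ha.nonempty i
    obtain ⟨y, hy⟩ := ha.nonempty n
    exact (hb y hy x (Finset.mem_biUnion.2 ⟨i, hi, hx⟩)).not_gt
      (ha.before_of_lt hlt x hx y hy)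

theorem tendsto_cofinite {G : Type*} [AddCommGroup G] {g : ℕ → G}
    (hg : IPTendstoInfty (ipSum g)) :
    Tendsto (fun k => ipSum g (a k)) atTop cofinite := by
  rw [← Function.comp_def (ipSum g), tendsto_def]
  intro s hs
  obtain ⟨α₀, _, h⟩ := hg (Filter.mem_cofinite.1 hs).toFinset
  obtain ⟨n, hn⟩ := ha.exists_mem_ring_before α₀
  filter_upwards [eventually_ge_atTop n] with k hk
  have := hn {k} (Finset.singleton_nonempty k) (by simpa using hk)
  rw [Finset.singleton_biUnion] at this
  simpa using h _ (ha.nonempty k) this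

end IsRingBase

theorem IsIPRing.exists_base {R : Set (Finset ℕ)} (hR : IsIPRing R) :
    ∃ a, IsRingBase a ∧ R = ringOf a :=
  let ⟨a, h1, h2, h3⟩ := hR
  ⟨a, ⟨h1, h2⟩, h3⟩

/-- Countably many limits along a union-idempotent ultrafilter hold simultaneously along an
IP-ring. -/
theorem IsUnionIdempotent.exists_ring {p : Ultrafilter (Finset ℕ)} (hp : IsUnionIdempotent p)
    {ι : Type*} [Countable ι] {x : ι → Finset ℕ → ℝ} {y : ι → ℝ}
    (h : ∀ i, Tendsto (x i) p (𝓝 (y i))) :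
    ∃ a, IsRingBase a ∧ ∀ i, Tendsto (x i) (ringFilter a) (𝓝 (y i)) := by
  obtain ⟨e, he⟩ := exists_injective_nat ι
  let S : ℕ → Set (Finset ℕ) := fun n =>
    ⋂ i ∈ {i | e i ≤ n}, {α | dist (x i α) (y i) < 1 / ((n : ℝ) + 1)}
  have hS : ∀ n, S n ∈ p := fun n =>
    (biInter_mem ((Set.finite_Iic n).preimage he.injOn)).2 fun i _ =>
      Metric.tendsto_nhds.1 (h i) _ (by positivity)
  -- Diagonalisation: after a_k, unions must meet the conditions coded up to max a_k with tolerance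
  -- 1/(max a_k + 1), and max a_k ≥ k.
  obtain ⟨a, ha, -, hT⟩ := galvin_glazer hp (S := Set.univ) univ_mem
    (T := fun β => S (β.sup id)) fun β => hS _
  refine ⟨a, ha, fun i => ?_⟩
  rw [(ringFilter_hasBasis a).tendsto_iff Metric.nhds_basis_ball]
  intro ε hε
  obtain ⟨n, hn⟩ := exists_nat_one_div_lt hε
  refine ⟨max n (e i) + 1, trivial, ?_⟩
  rintro _ ⟨α, h0, h1, rfl⟩
  have h2 := hT (max n (e i)) α h0 h1
  obtain ⟨z, hz⟩ := ha.nonempty (max n (e i))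
  have h3 : max n (e i) ≤ (a (max n (e i))).sup id :=
    (ha.le_of_mem hz).trans (Finset.le_sup (f := id) hz)
  have h4 := Set.mem_iInter₂.1 h2 i ((le_max_right _ _).trans h3)
  refine lt_of_lt_of_le (h4.trans_le ?_) hn.le
  have : (n : ℝ) ≤ ((a (max n (e i))).sup id : ℕ) := by
    exact_mod_cast (le_max_left _ _).trans h3
  gcongr

/-- If every sub-IP-system of every IP-system tending to infinity takes a value of `φ` close to
`y`, then `φ` converges to `y` along union-idempotent ultrafilters. -/
theorem IsUnionIdempotent.tendsto_of_forall_exists {p : Ultrafilter (Finset ℕ)}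
    (hp : IsUnionIdempotent p) {G : Type*} [AddCommGroup G] {φ : G → ℝ} {y : ℝ}
    (h : ∀ g : ℕ → G, IPTendstoInfty (ipSum g) → ∀ ε > 0,
      ∃ α : Finset ℕ, α.Nonempty ∧ |φ (ipSum g α) - y| < ε)
    {g : ℕ → G} (hg : IPTendstoInfty (ipSum g)) :
    Tendsto (fun α => φ (ipSum g α)) p (𝓝 y) := by
  refine Metric.tendsto_nhds.2 fun ε hε => ?_
  by_contra hcon
  obtain ⟨a, ha, hS, -⟩ := galvin_glazer hp (Ultrafilter.eventually_not.2 hcon)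
    (T := fun _ => Set.univ) fun _ => univ_mem
  obtain ⟨α, hα, hlt⟩ := h _ (ha.ipTendstoInfty hg) ε hε
  rw [← ha.ipSum_biUnion] at hlt
  exact hS α hα hlt

/-! ### A van der Corput lemma for union-idempotent ultrafilters -/

section VanDerCorput

variable {E : Type*} [NormedAddCommGroup E] [InnerProductSpace ℝ E]

theorem norm_sq_sum_range_le {u : ℕ → E} {K δ : ℝ} {N : ℕ} (hδ : 0 ≤ δ)
    (hK : ∀ i, ‖u i‖ ≤ K) (h : ∀ i j, i < j → j < N → inner ℝ (u i) (u j) ≤ δ) :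
    ‖∑ i ∈ Finset.range N, u i‖ ^ 2 ≤ N * K ^ 2 + N ^ 2 * δ := by
  have hle : ∀ i ∈ Finset.range N, ∀ j ∈ Finset.range N,
      inner ℝ (u i) (u j) ≤ (if i = j then K ^ 2 else 0) + δ := by
    intro i hi j hj
    rw [Finset.mem_range] at hi hj
    rcases lt_trichotomy i j with hij | rfl | hij
    · simpa [hij.ne] using h i j hij hj
    · rw [real_inner_self_eq_norm_sq, if_pos rfl]
      have := pow_le_pow_left₀ (norm_nonneg _) (hK i) 2
      linarith
    · rw [real_inner_comm]
      simpa [hij.ne'] using h j i hij hi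
  rw [← real_inner_self_eq_norm_sq, sum_inner]
  simp_rw [inner_sum]
  refine (Finset.sum_le_sum fun i hi => Finset.sum_le_sum fun j hj => hle i hi j hj).trans ?_
  simp only [Finset.sum_add_distrib, Finset.sum_const, Finset.card_range, nsmul_eq_mul,
    Finset.sum_ite_eq, Finset.mem_range]
  rw [Finset.sum_congr rfl (g := fun _ => K ^ 2) fun i hi => if_pos (Finset.mem_range.1 hi)]
  simp only [Finset.sum_const, Finset.card_range, nsmul_eq_mul]
  exact le_of_eq (by ring)

/-- Otherwise a whole ring satisfies ⟨x_α, v⟩ ≥ ε. Along it there are arbitrarily many nearly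
orthogonal vectors (up to one-sided error 2δ), so their sum is too short to have inner product at
least Nε with v. -/
theorem IsUnionIdempotent.eventually_inner_lt {p : Ultrafilter (Finset ℕ)}
    (hp : IsUnionIdempotent p) {x : Finset ℕ → E} {K : ℝ} (hK : ∀ α, ‖x α‖ ≤ K)
    {L : Finset ℕ → ℝ}
    (hL : ∀ β, Tendsto (fun α => inner ℝ (x (β ∪ α)) (x α)) p (𝓝 (L β)))
    (hL0 : Tendsto L p (𝓝 0)) (v : E) {ε : ℝ} (hε : 0 < ε) :
    ∀ᶠ α in (p : Filter (Finset ℕ)), inner ℝ (x α) v < ε := by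
  by_contra hcon
  have hcon := Ultrafilter.eventually_not.2 hcon
  -- With this δ the off-diagonal terms absorb at most half of (Nε)², leaving a bound linear in N
  -- that fails for large N.
  obtain ⟨δ, hδ, hδv⟩ : ∃ δ > 0, ‖v‖ ^ 2 * (2 * δ) ≤ ε ^ 2 / 2 := by
    refine ⟨ε ^ 2 / (4 * (‖v‖ ^ 2 + 1)), by positivity, ?_⟩
    have h4 : (0 : ℝ) < 4 * (‖v‖ ^ 2 + 1) := by positivity
    rw [show ‖v‖ ^ 2 * (2 * (ε ^ 2 / (4 * (‖v‖ ^ 2 + 1)))) =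
      (ε ^ 2 * (2 * ‖v‖ ^ 2)) / (4 * (‖v‖ ^ 2 + 1)) by ring, div_le_iff₀ h4]
    nlinarith [sq_nonneg ε]
  let T₀ : Finset ℕ → Set (Finset ℕ) := fun β =>
    {α | |inner ℝ (x (β ∪ α)) (x α) - L β| < δ}
  have hT₀ : ∀ β, T₀ β ∈ p := fun β => Metric.tendsto_nhds.1 (hL β) δ hδ
  -- The diagonal condition sees only a_k, so it is imposed for every γ ⊆ {0, …, max a_k}; this
  -- covers all unions a_i ∪ ⋯ ∪ a_k.
  obtain ⟨a, ha, hS, hT⟩ := galvin_glazer hp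
    (inter_mem hcon (Metric.tendsto_nhds.1 hL0 δ hδ) : _ ∈ (p : Filter (Finset ℕ)))
    (T := fun β => ⋂ γ ∈ ((Finset.range (β.sup id + 1)).powerset : Set (Finset ℕ)), T₀ γ)
    (fun β => (biInter_mem (Finset.finite_toSet _)).2 fun γ _ => hT₀ γ)
  have key : ∀ N : ℕ, (N : ℝ) * ε ^ 2 / 2 ≤ ‖v‖ ^ 2 * K ^ 2 := by
    intro N
    rcases Nat.eq_zero_or_pos N with rfl | hN
    · simp only [Nat.cast_zero, zero_mul, zero_div]; positivity
    -- Nested unions: for i < j the index of u_i is β ∪ α, with β = a_i ∪ ⋯ ∪ a_{j-1} and α the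
    -- index of u_j.
    let u : ℕ → E := fun i => x ((Finset.Ico i N).biUnion a)
    have hu : ∀ i j, i < j → j < N → inner ℝ (u i) (u j) ≤ 2 * δ := by
      intro i j hij hj
      obtain ⟨k, rfl⟩ : ∃ k, j = k + 1 := ⟨j - 1, by omega⟩
      have h1 := hS (Finset.Ico i (k + 1)) (Finset.nonempty_Ico.2 hij)
      have h2 := hT k (Finset.Ico (k + 1) N) (Finset.nonempty_Ico.2 hj)
        fun i hi => (Finset.mem_Ico.1 hi).1
      have h3 : |inner ℝ (x ((Finset.Ico i (k + 1)).biUnion a ∪ (Finset.Ico (k + 1) N).biUnion a))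
          (u (k + 1)) - L ((Finset.Ico i (k + 1)).biUnion a)| < δ := by
        refine Set.mem_iInter₂.1 h2 _ (Finset.mem_coe.2 (Finset.mem_powerset.2 fun z hz => ?_))
        obtain ⟨l, hl, hzl⟩ := Finset.mem_biUnion.1 hz
        rw [Finset.mem_range, Nat.lt_succ_iff]
        rcases (Nat.lt_succ_iff.1 (Finset.mem_Ico.1 hl).2).eq_or_lt with rfl | hlk
        · exact Finset.le_sup (f := id) hzl
        · obtain ⟨y, hy⟩ := ha.nonempty k
          exact (ha.before_of_lt hlk z hzl y hy).le.trans (Finset.le_sup (f := id) hy)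
      rw [← Finset.union_biUnion, Finset.Ico_union_Ico_eq_Ico hij.le hj.le] at h3
      have h4 : |L ((Finset.Ico i (k + 1)).biUnion a) - 0| < δ := h1.2
      rw [sub_zero] at h4
      have h5 : inner ℝ (u i) (u (k + 1)) - _ < δ := (abs_lt.1 h3).2
      have h6 := (abs_lt.1 h4).2
      linarith
    have hsq := norm_sq_sum_range_le (N := N) (by positivity : (0 : ℝ) ≤ 2 * δ)
      (fun i => hK _) hu
    have hlow : (N : ℝ) * ε ≤ inner ℝ (∑ i ∈ Finset.range N, u i) v := by
      rw [sum_inner, ← nsmul_eq_mul]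
      conv_lhs => rw [← Finset.card_range N]
      refine Finset.card_nsmul_le_sum _ _ _ fun i hi => ?_
      exact not_lt.1 (hS _ (Finset.nonempty_Ico.2 (Finset.mem_range.1 hi))).1
    have hcs := hlow.trans (real_inner_le_norm _ _)
    have hcs2 := pow_le_pow_left₀ (by positivity) hcs 2
    rw [mul_pow, mul_pow] at hcs2
    have hN' : (0 : ℝ) < N := by exact_mod_cast hN
    have h5 := mul_le_mul_of_nonneg_right hsq (sq_nonneg ‖v‖)
    have h6 := mul_le_mul_of_nonneg_left hδv (sq_nonneg (N : ℝ))
    refine le_of_mul_le_mul_left ?_ hN'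
    nlinarith
  obtain ⟨N, hN⟩ := exists_nat_gt (‖v‖ ^ 2 * K ^ 2 / (ε ^ 2 / 2))
  rw [div_lt_iff₀ (by positivity)] at hN
  have := key N
  rw [mul_div_assoc] at this
  exact this.not_gt hN

theorem IsUnionIdempotent.tendsto_inner_zero {p : Ultrafilter (Finset ℕ)}
    (hp : IsUnionIdempotent p) {x : Finset ℕ → E} {K : ℝ} (hK : ∀ α, ‖x α‖ ≤ K)
    {L : Finset ℕ → ℝ}
    (hL : ∀ β, Tendsto (fun α => inner ℝ (x (β ∪ α)) (x α)) p (𝓝 (L β)))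
    (hL0 : Tendsto L p (𝓝 0)) (v : E) : Tendsto (fun α => inner ℝ (x α) v) p (𝓝 0) := by
  refine Metric.tendsto_nhds.2 fun ε hε => ?_
  filter_upwards [hp.eventually_inner_lt hK hL hL0 v hε,
    hp.eventually_inner_lt hK hL hL0 (-v) hε] with α h1 h2
  rw [inner_neg_right] at h2
  rw [Real.dist_eq, sub_zero, abs_lt]
  exact ⟨by linarith, h1⟩

end VanDerCorput

/-! ### Multiple mixing along IP-systems of a mildly mixing action -/

section BddMeasurable

variable {X : Type*} [MeasurableSpace X]

/-- Bounded measurable real functions. -/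
structure IsBddMeasurable (f : X → ℝ) : Prop where
  measurable : Measurable f
  bdd : ∃ C, ∀ x, |f x| ≤ C

namespace IsBddMeasurable

variable {f h : X → ℝ}

theorem mul (hf : IsBddMeasurable f) (hh : IsBddMeasurable h) :
    IsBddMeasurable fun x => f x * h x := by
  refine ⟨hf.1.mul hh.1, ?_⟩
  obtain ⟨C, hC⟩ := hf.2
  obtain ⟨D, hD⟩ := hh.2
  refine ⟨C * D, fun x => ?_⟩
  rw [abs_mul]
  exact mul_le_mul (hC x) (hD x) (abs_nonneg _) ((abs_nonneg _).trans (hC x))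

theorem comp (hf : IsBddMeasurable f) {T : X → X} (hT : Measurable T) :
    IsBddMeasurable fun x => f (T x) :=
  ⟨hf.1.comp hT, hf.2.imp fun _ hC x => hC (T x)⟩

theorem prod {ι : Type*} [Fintype ι] {F : ι → X → ℝ} (hF : ∀ i, IsBddMeasurable (F i)) :
    IsBddMeasurable fun x => ∏ i, F i x := by
  choose C hC using fun i => (hF i).2
  refine ⟨Finset.measurable_fun_prod _ fun i _ => (hF i).1, ∏ i, C i, fun x => ?_⟩
  rw [Finset.abs_prod]
  exact Finset.prod_le_prod (fun _ _ => abs_nonneg _) fun i _ => hC i x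

theorem indicator {A : Set X} (hA : MeasurableSet A) :
    IsBddMeasurable (A.indicator fun _ => (1 : ℝ)) := by
  refine ⟨measurable_const.indicator hA, 1, fun x => ?_⟩
  by_cases hx : x ∈ A <;> simp [hx]

variable {μ : Measure X} [IsFiniteMeasure μ]

theorem memLp (hf : IsBddMeasurable f) {q : ENNReal} : MemLp f q μ :=
  let ⟨C, hC⟩ := hf.2
  MemLp.of_bound hf.1.aestronglyMeasurable C (.of_forall hC)

theorem integrable (hf : IsBddMeasurable f) : Integrable f μ :=
  memLp_one_iff_integrable.1 hf.memLp

end IsBddMeasurable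

theorem inner_toLp_toLp {μ : Measure X} {f h : X → ℝ} (hf : MemLp f 2 μ) (hh : MemLp h 2 μ) :
    inner ℝ (hf.toLp f) (hh.toLp h) = ∫ x, f x * h x ∂μ := by
  rw [L2.inner_def]
  refine integral_congr_ae ?_
  filter_upwards [hf.coeFn_toLp, hh.coeFn_toLp] with x h1 h2
  rw [h1, h2, real_inner_eq_re_inner, RCLike.inner_apply]
  simp [mul_comm]

theorem norm_toLp_le {μ : Measure X} [IsProbabilityMeasure μ] {f : X → ℝ} (hf : MemLp f 2 μ)
    {K : ℝ} (hK : ∀ x, |f x| ≤ K) (hK0 : 0 ≤ K) : ‖hf.toLp f‖ ≤ K := by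
  refine (Lp.norm_le_of_ae_bound hK0 (f := hf.toLp f) ?_).trans ?_
  · filter_upwards [hf.coeFn_toLp] with x hx
    rw [hx]
    exact hK x
  · simp [measureUnivNNReal]

end BddMeasurable

section Action

variable {G : Type*} [AddCommGroup G] {X : Type*} [MeasurableSpace X] [AddAction G X]
  [MeasurableConstVAdd G X] {μ : Measure X} [IsProbabilityMeasure μ] [VAddInvariantMeasure G X μ]

omit [MeasurableConstVAdd G X] [VAddInvariantMeasure G X μ] in
-- The ring given by mild mixing depends on the sequence, while p is fixed; one good value on each
-- ring suffices for `tendsto_of_forall_exists`.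
theorem IsMildlyMixing.tendsto_integral_mul (hM : IsMildlyMixing G μ) {p : Ultrafilter (Finset ℕ)}
    (hp : IsUnionIdempotent p) {g : ℕ → G} (hg : IPTendstoInfty (ipSum g)) {f h : X → ℝ}
    (hf : IsBddMeasurable f) (hh : IsBddMeasurable h) :
    Tendsto (fun α => ∫ x, f (ipSum g α +ᵥ x) * h x ∂μ) p (𝓝 ((∫ x, f x ∂μ) * ∫ x, h x ∂μ)) := by
  refine hp.tendsto_of_forall_exists (φ := fun c => ∫ x, f (c +ᵥ x) * h x ∂μ) ?_ hg
  intro g hg ε hε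
  obtain ⟨R, hR, hlim⟩ := hM g hg
  obtain ⟨a, ha, rfl⟩ := hR.exists_base
  have h1 := hlim (fun x => (f x : ℂ)) hf.memLp.ofReal (fun x => (h x : ℂ)) hh.memLp.ofReal
  rw [ha.ipLim_iff] at h1
  obtain ⟨k, hk⟩ := (Metric.tendsto_nhds.1 (h1.comp (tendsto_ringFilter a)) ε hε).exists
  refine ⟨a k, ha.nonempty k, ?_⟩
  simp only [Function.comp_apply, Complex.conj_ofReal, integral_const_mul] at hk
  norm_cast at hk
  rwa [Complex.dist_eq, ← Complex.ofReal_sub, Complex.norm_real] at hk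

/-- Multiple mixing of order `ℓ` along union-idempotent ultrafilters. -/
def IsMultiplyMixing (μ : Measure X) (G : Type*) [AddCommGroup G] [AddAction G X]
    (p : Ultrafilter (Finset ℕ)) (ℓ : ℕ) : Prop :=
  ∀ g : Fin ℓ → ℕ → G, IsIPTildeGenerator g → ∀ f₀ : X → ℝ, IsBddMeasurable f₀ →
    ∀ f : Fin ℓ → X → ℝ, (∀ j, IsBddMeasurable (f j)) →
      Tendsto (fun α => ∫ x, f₀ x * ∏ j, f j (ipSum (g j) α +ᵥ x) ∂μ) p
        (𝓝 ((∫ x, f₀ x ∂μ) * ∏ j, ∫ x, f j x ∂μ))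

omit [IsProbabilityMeasure μ] in
-- Invariance cancels the translation by g^{(0)}. The ℓ differences g^{(i)} - g^{(0)} again satisfy
-- (∗), since g^{(0)} drops out of their own differences.
theorem IsMultiplyMixing.tendsto_integral_prod {p : Ultrafilter (Finset ℕ)} {ℓ : ℕ}
    (h : IsMultiplyMixing μ G p ℓ) {g : Fin (ℓ + 1) → ℕ → G} (hg : IsIPTildeGenerator g)
    {F : Fin (ℓ + 1) → X → ℝ} (hF : ∀ j, IsBddMeasurable (F j)) :
    Tendsto (fun α => ∫ x, ∏ j, F j (ipSum (g j) α +ᵥ x) ∂μ) p (𝓝 (∏ j, ∫ x, F j x ∂μ)) := by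
  have hsub : ∀ i α, ipSum (fun k => g i k - g 0 k) α = ipSum (g i) α - ipSum (g 0) α :=
    fun i α => Finset.sum_sub_distrib _ _
  have hg' : IsIPTildeGenerator fun (i : Fin ℓ) k => g i.succ k - g 0 k := by
    refine ⟨fun i => ?_, fun i j hij => ?_⟩
    · simpa only [hsub, ← funext (hsub i.succ)] using hg.2 0 i.succ (Fin.succ_ne_zero i).symm
    · simpa only [hsub, sub_sub_sub_cancel_right] using
        hg.2 i.succ j.succ ((Fin.succ_injective _).ne hij)
  rw [Fin.prod_univ_succ]
  refine (h _ hg' (F 0) (hF 0) (fun i => F i.succ) fun i => hF _).congr fun α => ?_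
  rw [← integral_vadd_eq_self (μ := μ) _ (g := ipSum (g 0) α)]
  refine integral_congr_ae (.of_forall fun x => ?_)
  simp only [Fin.prod_univ_succ, vadd_vadd, hsub, sub_add_cancel]

/-- Van der Corput is applied in L² to x_α = ∏ f_j ∘ T_{g^{(j)}_α} - C, then tested against f₀. -/
theorem IsMultiplyMixing.succ (hM : IsMildlyMixing G μ) {p : Ultrafilter (Finset ℕ)}
    (hp : IsUnionIdempotent p) {ℓ : ℕ} (h : IsMultiplyMixing μ G p ℓ) :
    IsMultiplyMixing μ G p (ℓ + 1) := by
  intro g hg f₀ hf₀ f hf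
  set C : ℝ := ∏ j, ∫ x, f j x ∂μ with hC
  have hcomp : ∀ j (c : G), IsBddMeasurable fun x => f j (c +ᵥ x) :=
    fun j c => (hf j).comp (measurable_const_vadd c)
  let P : Finset ℕ → X → ℝ := fun α x => ∏ j, f j (ipSum (g j) α +ᵥ x)
  have hP : ∀ α, IsBddMeasurable (P α) := fun α => .prod fun j => hcomp j _
  have hmem : ∀ α, MemLp (fun x => P α x - C) 2 μ := fun α => (hP α).memLp.sub (memLp_const C)
  choose D hD using fun j => (hf j).2
  have hPb : ∀ α x, |P α x - C| ≤ ∏ j, D j + |C| := by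
    intro α x
    refine (abs_sub _ _).trans (add_le_add_left ?_ _)
    rw [Finset.abs_prod]
    exact Finset.prod_le_prod (fun _ _ => abs_nonneg _) fun j _ => hD j _
  have hD0 : 0 ≤ ∏ j, D j + |C| := by
    obtain ⟨x⟩ := nonempty_of_isProbabilityMeasure μ
    exact (abs_nonneg _).trans (hPb ∅ x)
  -- The correlation limit: the order-ℓ hypothesis is applied to the functions (f_j ∘ T_{g^{(j)}_β})
  -- f_j, and each of the three remaining terms contributes ±C².
  let L : Finset ℕ → ℝ := fun β =>
    (∏ j, ∫ x, f j (ipSum (g j) β +ᵥ x) * f j x ∂μ) - C * C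
  have hinv : ∀ j (c : G), ∫ x, f j (c +ᵥ x) ∂μ = ∫ x, f j x ∂μ :=
    fun j c => integral_vadd_eq_self (μ := μ) (f j)
  have hL : ∀ β, Tendsto (fun α => inner ℝ ((hmem (β ∪ α)).toLp _) ((hmem α).toLp _)) p
      (𝓝 (L β)) := by
    intro β
    have t1 := h.tendsto_integral_prod hg
      (F := fun j x => f j (ipSum (g j) β +ᵥ x) * f j x) fun j => (hcomp j _).mul (hf j)
    have t2 := h.tendsto_integral_prod hg
      (F := fun j x => f j (ipSum (g j) β +ᵥ x)) fun j => hcomp j _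
    have t3 := h.tendsto_integral_prod hg hf
    simp only [hinv, ← hC] at t2 t3
    have t := ((t1.sub (t2.mul_const C)).sub (t3.mul_const C)).add_const (C * C)
    rw [show ∏ j, ∫ x, f j (ipSum (g j) β +ᵥ x) * f j x ∂μ - C * C - C * C + C * C = L β by
      simp only [L]; ring] at t
    refine t.congr' ?_
    -- Past max β the sets are disjoint, so g_{β∪α} = g_β + g_α.
    filter_upwards [hp.tail (β.sup id + 1)] with α hα
    have hdisj : Disjoint β α := Finset.disjoint_left.2 fun x hx hxα =>
      absurd (hα.2 x hxα) (by
        have := Finset.le_sup (f := id) hx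
        simp only [id] at this
        omega)
    have hun : ∀ j (x : X), ipSum (g j) (β ∪ α) +ᵥ x = ipSum (g j) β +ᵥ (ipSum (g j) α +ᵥ x) := by
      intro j x
      rw [vadd_vadd]
      congr 1
      exact Finset.sum_union hdisj
    rw [inner_toLp_toLp]
    have e : ∀ x, (P (β ∪ α) x - C) * (P α x - C) =
        P (β ∪ α) x * P α x - P (β ∪ α) x * C - P α x * C + C * C := fun x => by ring
    simp_rw [e]
    have i1 := ((hP (β ∪ α)).mul (hP α)).integrable (μ := μ)
    have i2 := (hP (β ∪ α)).integrable (μ := μ) |>.mul_const C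
    have i3 := (hP α).integrable (μ := μ) |>.mul_const C
    have i12 : Integrable (fun x => P (β ∪ α) x * P α x - P (β ∪ α) x * C) μ := i1.sub i2
    have i123 : Integrable (fun x => P (β ∪ α) x * P α x - P (β ∪ α) x * C - P α x * C) μ :=
      i12.sub i3
    rw [integral_add i123 (integrable_const _), integral_sub i12 i3, integral_sub i1 i2, integral_mul_const, integral_mul_const, integral_const]
    simp only [P, hun, ← Finset.prod_mul_distrib, probReal_univ, one_smul]
  have hL0 : Tendsto L p (𝓝 0) := by
    have : Tendsto L p (𝓝 ((∏ j, (∫ x, f j x ∂μ) * ∫ x, f j x ∂μ) - C * C)) :=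
      (tendsto_finsetProd _ fun j _ =>
        hM.tendsto_integral_mul hp (hg.1 j) (hf j) (hf j)).sub_const _
    rwa [Finset.prod_mul_distrib, sub_self] at this
  have key := hp.tendsto_inner_zero (x := fun α => (hmem α).toLp _)
    (fun α => norm_toLp_le _ (hPb α) hD0) hL hL0 (hf₀.memLp.toLp f₀)
  have key' := key.add_const ((∫ x, f₀ x ∂μ) * C)
  rw [zero_add] at key'
  refine key'.congr fun α => ?_
  rw [inner_toLp_toLp]
  have e : ∀ x, (P α x - C) * f₀ x = f₀ x * P α x - f₀ x * C := fun x => by ring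
  simp_rw [e]
  rw [integral_sub (hf₀.mul (hP α)).integrable (hf₀.integrable.mul_const C), integral_mul_const,
    sub_add_cancel]

theorem IsMildlyMixing.isMultiplyMixing (hM : IsMildlyMixing G μ) {p : Ultrafilter (Finset ℕ)}
    (hp : IsUnionIdempotent p) (ℓ : ℕ) : IsMultiplyMixing μ G p ℓ := by
  induction ℓ with
  | zero => intro g _ f₀ _ f _; simp
  | succ ℓ ih => exact ih.succ hM hp

end Action

/-! ### From sets to `L²` and from a dense family to all measurable sets -/

/-- A pointwise limit of uniformly Lipschitz functions that exists on a dense set exists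
everywhere. -/
theorem isClosed_setOf_tendsto {E β Y : Type*} [PseudoMetricSpace E] [PseudoMetricSpace Y]
    {F : Filter β} {φ : β → E → Y} {ψ : E → Y} (K : NNReal) (hφ : ∀ b, LipschitzWith K (φ b))
    (hψ : Continuous ψ) : IsClosed {u | Tendsto (fun b => φ b u) F (𝓝 (ψ u))} := by
  refine isClosed_of_closure_subset fun u hu => Metric.tendsto_nhds.2 fun ε hε => ?_
  have h1 : ∀ᶠ w in 𝓝 u, dist (ψ w) (ψ u) < ε / 3 :=
    Metric.tendsto_nhds.1 (hψ.tendsto u) _ (by positivity)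
  have h2 : ∀ᶠ w in 𝓝 u, K * dist u w < ε / 3 := by
    have : Tendsto (fun w => K * dist u w) (𝓝 u) (𝓝 (K * dist u u)) :=
      (continuous_const.mul (continuous_const.dist continuous_id)).tendsto u
    rw [dist_self, mul_zero] at this
    exact this.eventually (gt_mem_nhds (by positivity))
  obtain ⟨w, hw, hw1, hw2⟩ := ((mem_closure_iff_frequently.1 hu).and_eventually (h1.and h2)).exists
  filter_upwards [Metric.tendsto_nhds.1 hw (ε / 3) (by positivity)] with b hb
  have h3 := (hφ b).dist_le_mul u w
  have h4 := dist_triangle4 (φ b u) (φ b w) (ψ w) (ψ u)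
  linarith

theorem abs_prod_sub_prod_le {ι : Type*} (s : Finset ι) {x y : ι → ℝ} (hx : ∀ i, |x i| ≤ 1)
    (hy : ∀ i, |y i| ≤ 1) : |∏ i ∈ s, x i - ∏ i ∈ s, y i| ≤ ∑ i ∈ s, |x i - y i| := by
  classical
  induction s using Finset.induction_on with
  | empty => simp
  | insert i s hi ih =>
    rw [Finset.prod_insert hi, Finset.prod_insert hi, Finset.sum_insert hi,
      show x i * ∏ j ∈ s, x j - y i * ∏ j ∈ s, y j =
        (x i - y i) * ∏ j ∈ s, x j + y i * (∏ j ∈ s, x j - ∏ j ∈ s, y j) by ring]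
    refine (abs_add_le _ _).trans (add_le_add ?_ ?_)
    · rw [abs_mul, Finset.abs_prod]
      exact mul_le_of_le_one_right (abs_nonneg _)
        (Finset.prod_le_one (fun _ _ => abs_nonneg _) fun j _ => hx j)
    · rw [abs_mul]
      exact (mul_le_of_le_one_left (abs_nonneg _) (hy i)).trans ih

section Action

variable {G : Type*} [AddCommGroup G] {X : Type*} [MeasurableSpace X] [AddAction G X]
  [MeasurableConstVAdd G X] {μ : Measure X} [IsProbabilityMeasure μ] [VAddInvariantMeasure G X μ]

theorem abs_multiCorr_sub_le {ℓ : ℕ} {A B : Fin (ℓ + 1) → Set X} (hA : ∀ j, MeasurableSet (A j))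
    (hB : ∀ j, MeasurableSet (B j)) (g : Fin ℓ → G) :
    |multiCorr μ A g - multiCorr μ B g| ≤ ∑ j, μ.real (symmDiff (A j) (B j)) := by
  have hm : ∀ {A : Fin (ℓ + 1) → Set X}, (∀ j, MeasurableSet (A j)) →
      MeasurableSet (A 0 ∩ ⋂ j : Fin ℓ, (g j +ᵥ A j.succ)) := fun hA =>
    (hA 0).inter (.iInter fun j => (hA _).const_vadd (g j))
  refine (abs_measureReal_sub_le_measureReal_symmDiff' (hm hA).nullMeasurableSet
    (hm hB).nullMeasurableSet (measure_ne_top _ _) (measure_ne_top _ _)).trans ?_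
  have hsub : symmDiff (A 0 ∩ ⋂ j : Fin ℓ, (g j +ᵥ A j.succ))
      (B 0 ∩ ⋂ j : Fin ℓ, (g j +ᵥ B j.succ)) ⊆
      symmDiff (A 0) (B 0) ∪ ⋃ j : Fin ℓ, (g j +ᵥ symmDiff (A j.succ) (B j.succ)) := by
    intro x hx
    simp only [Set.vadd_set_symmDiff, Set.mem_union, Set.mem_iUnion, Set.mem_symmDiff,
      Set.mem_inter_iff, Set.mem_iInter] at hx ⊢
    by_contra! hcon
    obtain ⟨⟨h1, h2⟩, h3⟩ := hcon
    rcases hx with ⟨⟨ha, ha'⟩, hb⟩ | ⟨⟨ha, ha'⟩, hb⟩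
    · exact hb ⟨h1 ha, fun j => (h3 j).1 (ha' j)⟩
    · exact hb ⟨h2 ha, fun j => (h3 j).2 (ha' j)⟩
  refine (measureReal_mono hsub).trans ((measureReal_union_le _ _).trans ?_)
  rw [Fin.sum_univ_succ]
  refine add_le_add le_rfl ((measureReal_iUnion_fintype_le _).trans (le_of_eq ?_))
  simp [Measure.real, measure_vadd]

/-- Convergence of multiple correlations only has to be tested on a dense family of sets. -/
theorem tendsto_multiCorr_of_measureDense {ℓ : ℕ} {β : Type*} {F : Filter β} {c : β → Fin ℓ → G}
    {𝒜 : Set (Set X)} (h𝒜 : μ.MeasureDense 𝒜)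
    (h : ∀ B : Fin (ℓ + 1) → 𝒜, Tendsto (fun b => multiCorr μ (fun j => (B j : Set X)) (c b)) F
      (𝓝 (∏ j, μ.real (B j : Set X))))
    {A : Fin (ℓ + 1) → Set X} (hA : ∀ j, MeasurableSet (A j)) :
    Tendsto (fun b => multiCorr μ A (c b)) F (𝓝 (∏ j, μ.real (A j))) := by
  refine Metric.tendsto_nhds.2 fun ε hε => ?_
  have hδ : 0 < ε / (3 * (ℓ + 1)) := by positivity
  choose B hB hAB using fun j => h𝒜.approx (A j) (hA j) (measure_ne_top _ _) _ hδ
  have hBm : ∀ j, MeasurableSet (B j) := fun j => h𝒜.measurable _ (hB j)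
  have hsum : ∑ j, μ.real (symmDiff (A j) (B j)) ≤ ε / 3 := by
    have h1 : ∀ j, μ.real (symmDiff (A j) (B j)) ≤ ε / (3 * (ℓ + 1)) := fun j =>
      ENNReal.toReal_le_of_le_ofReal hδ.le (hAB j).le
    refine (Finset.sum_le_sum fun j _ => h1 j).trans (le_of_eq ?_)
    rw [Finset.sum_const, Finset.card_univ, Fintype.card_fin, nsmul_eq_mul]
    push_cast
    field_simp
  have hle1 : ∀ {A : Fin (ℓ + 1) → Set X} j, |μ.real (A j)| ≤ 1 := fun j => by
    rw [abs_of_nonneg measureReal_nonneg]; exact measureReal_le_one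
  have hprod : |∏ j, μ.real (A j) - ∏ j, μ.real (B j)| ≤ ε / 3 := by
    refine (abs_prod_sub_prod_le _ hle1 hle1).trans (le_trans ?_ hsum)
    exact Finset.sum_le_sum fun j _ => abs_measureReal_sub_le_measureReal_symmDiff'
      (hA j).nullMeasurableSet (hBm j).nullMeasurableSet (measure_ne_top _ _) (measure_ne_top _ _)
  filter_upwards [Metric.tendsto_nhds.1 (h fun j => ⟨B j, hB j⟩) (ε / 3) (by positivity)] with b hb
  have h1 := (abs_multiCorr_sub_le (μ := μ) hA hBm (c b)).trans hsum
  rw [Real.dist_eq] at hb ⊢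
  rw [abs_le] at h1 hprod
  rw [abs_lt] at hb ⊢
  constructor <;> linarith [h1.1, h1.2, hprod.1, hprod.2, hb.1, hb.2]

omit [MeasurableSpace X] [MeasurableConstVAdd G X] [IsProbabilityMeasure μ]
  [VAddInvariantMeasure G X μ] in
theorem preimage_vadd_eq_neg_vadd (c : G) (A : Set X) : (fun x => c +ᵥ x) ⁻¹' A = -c +ᵥ A := by
  rw [Set.preimage_vadd]

omit [MeasurableConstVAdd G X] [IsProbabilityMeasure μ] [VAddInvariantMeasure G X μ] in
-- The sign appears because correlations use images T_g A while mixing uses preimages.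
theorem multiCorr_one (A : Fin 2 → Set X) (c : G) :
    multiCorr μ A (fun _ => -c) = μ.real (A 0 ∩ (fun x => c +ᵥ x) ⁻¹' A 1) := by
  rw [preimage_vadd_eq_neg_vadd, multiCorr]
  congr 2
  ext x
  simp

omit [IsProbabilityMeasure μ] [VAddInvariantMeasure G X μ] in
theorem multiCorr_eq_integral {ℓ : ℕ} {A : Fin (ℓ + 1) → Set X} (hA : ∀ j, MeasurableSet (A j))
    (g : Fin ℓ → G) :
    multiCorr μ A g = ∫ x, (A 0).indicator (fun _ => (1 : ℝ)) x *
      ∏ j : Fin ℓ, (A j.succ).indicator (fun _ => (1 : ℝ)) (-g j +ᵥ x) ∂μ := by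
  have hm : MeasurableSet (A 0 ∩ ⋂ j : Fin ℓ, (g j +ᵥ A j.succ)) :=
    (hA 0).inter (.iInter fun j => (hA _).const_vadd (g j))
  rw [multiCorr, ← integral_indicator_one hm]
  refine integral_congr_ae (.of_forall fun x => ?_)
  dsimp only
  have hj : ∀ j : Fin ℓ, (A j.succ).indicator (fun _ => (1 : ℝ)) (-g j +ᵥ x) =
      (g j +ᵥ A j.succ).indicator (fun _ => (1 : ℝ)) x := by
    intro j
    by_cases hx : x ∈ g j +ᵥ A j.succ
    · rw [Set.indicator_of_mem hx, Set.indicator_of_mem (Set.mem_vadd_set_iff_neg_vadd_mem.1 hx)]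
    · rw [Set.indicator_of_notMem hx,
        Set.indicator_of_notMem fun h => hx (Set.mem_vadd_set_iff_neg_vadd_mem.2 h)]
  simp_rw [hj]
  by_cases hx : x ∈ A 0 ∩ ⋂ j : Fin ℓ, (g j +ᵥ A j.succ)
  · rw [Set.indicator_of_mem hx, Set.indicator_of_mem hx.1, Finset.prod_eq_one fun j _ =>
      Set.indicator_of_mem (Set.mem_iInter.1 hx.2 j) _]
    simp
  · rw [Set.indicator_of_notMem hx]
    by_cases h0 : x ∈ A 0
    · obtain ⟨j, hxj⟩ : ∃ j : Fin ℓ, x ∉ g j +ᵥ A j.succ := by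
        by_contra! hcon
        exact hx ⟨h0, Set.mem_iInter.2 hcon⟩
      rw [Finset.prod_eq_zero (Finset.mem_univ j) (Set.indicator_of_notMem hxj _), mul_zero]
    · rw [Set.indicator_of_notMem h0, zero_mul]

/-- Weak convergence in `L²` only has to be tested on indicators of measurable sets. -/
theorem tendsto_integral_mul_conj {β : Type*} {F : Filter β} {c : β → G}
    (h : ∀ A₀ A₁ : Set X, MeasurableSet A₀ → MeasurableSet A₁ →
      Tendsto (fun b => μ.real (A₀ ∩ (fun x => c b +ᵥ x) ⁻¹' A₁)) F (𝓝 (μ.real A₀ * μ.real A₁)))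
    {f k : X → ℂ} (hf : MemLp f 2 μ) (hk : MemLp k 2 μ) :
    Tendsto (fun b => ∫ x, f (c b +ᵥ x) * (starRingEnd ℂ) (k x) ∂μ) F
      (𝓝 (∫ x, (∫ y, f y ∂μ) * (starRingEnd ℂ) (k x) ∂μ)) := by
  let U : β → Lp ℂ 2 μ →ₗᵢ[ℂ] Lp ℂ 2 μ := fun b =>
    Lp.compMeasurePreservingₗᵢ ℂ (c b +ᵥ ·) (measurePreserving_vadd (c b) μ)
  let one : Lp ℂ 2 μ := indicatorConstLp 2 MeasurableSet.univ (measure_ne_top μ _) 1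
  let ψ : Lp ℂ 2 μ → Lp ℂ 2 μ → ℂ := fun v u => inner ℂ one u * inner ℂ v one
  -- The maps `U b` are isometries, so the pairings are uniformly Lipschitz in each variable and
  -- `Lp.induction` can be run twice, down to indicators.
  have hclosed : ∀ v, IsClosed {u | Tendsto (fun b => inner ℂ v (U b u)) F (𝓝 (ψ v u))} := by
    intro v
    refine isClosed_setOf_tendsto (φ := fun b u => inner ℂ v (U b u)) ‖v‖₊ (fun b => ?_) ?_
    · refine LipschitzWith.of_dist_le_mul fun u w => ?_
      rw [dist_eq_norm, dist_eq_norm, ← inner_sub_right, ← map_sub, coe_nnnorm]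
      exact (norm_inner_le_norm _ _).trans_eq (by rw [(U b).norm_map])
    · exact (continuous_const.inner continuous_id).mul continuous_const
  have hclosed' : ∀ u, IsClosed {v | Tendsto (fun b => inner ℂ v (U b u)) F (𝓝 (ψ v u))} := by
    intro u
    refine isClosed_setOf_tendsto (φ := fun b v => inner ℂ v (U b u)) ‖u‖₊ (fun b => ?_) ?_
    · refine LipschitzWith.of_dist_le_mul fun v w => ?_
      rw [dist_eq_norm, dist_eq_norm, ← inner_sub_left, coe_nnnorm]
      exact (norm_inner_le_norm _ _).trans_eq (by rw [(U b).norm_map, mul_comm])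
    · exact continuous_const.mul (continuous_id.inner continuous_const)
  have key : ∀ v u, Tendsto (fun b => inner ℂ v (U b u)) F (𝓝 (ψ v u)) := by
    intro v u
    revert v
    refine Lp.induction (by simp) _ ?_ ?_ (hclosed' u)
    · intro s B hB hμB
      revert u
      refine Lp.induction (by simp) _ ?_ ?_ (hclosed _)
      · intro r A hA hμA
        have h1 := (h B A hB hA).smul_const (inner ℂ s r)
        convert! h1 using 2
        · simp only [U, Lp.simpleFunc.coe_indicatorConst]
          change inner ℂ _ (Lp.compMeasurePreserving _ _ _) = _
          rw [Lp.indicatorConstLp_compMeasurePreserving,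
            L2.inner_indicatorConstLp_indicatorConstLp]
        · simp only [ψ, one, Lp.simpleFunc.coe_indicatorConst,
            L2.inner_indicatorConstLp_indicatorConstLp, Set.univ_inter, Set.inter_univ]
          simp
          ring
      · intro f g hf hg _ h1 h2
        have := h1.add h2
        simpa only [map_add, inner_add_right, ψ, add_mul] using this
    · intro f g hf hg _ h1 h2
      have := h1.add h2
      simpa only [inner_add_left, ψ, mul_add] using this
  have hinner : ∀ {f k : X → ℂ} (hf : MemLp f 2 μ) (hk : MemLp k 2 μ),
      inner ℂ (hk.toLp k) (hf.toLp f) = ∫ x, f x * (starRingEnd ℂ) (k x) ∂μ := by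
    intro f k hf hk
    rw [L2.inner_def]
    refine integral_congr_ae ?_
    filter_upwards [hf.coeFn_toLp, hk.coeFn_toLp] with x h1 h2
    rw [h1, h2, RCLike.inner_apply]
  have hone : one = (memLp_const (1 : ℂ)).toLp (fun _ : X => (1 : ℂ)) := by
    refine Lp.ext ?_
    filter_upwards [indicatorConstLp_coeFn (p := 2) (hs := MeasurableSet.univ)
      (hμs := measure_ne_top μ _) (c := (1 : ℂ)),
      (memLp_const (1 : ℂ)).coeFn_toLp (p := 2) (μ := μ)] with x h1 h2
    rw [h2, h1, Set.indicator_univ]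
  have hlim := key (hk.toLp k) (hf.toLp f)
  simp only [ψ, hone, hinner] at hlim
  rw [integral_const_mul]
  simp only [map_one, mul_one, one_mul] at hlim
  refine hlim.congr fun b => ?_
  exact hinner (hf.comp_measurePreserving (measurePreserving_vadd (c b) μ)) hk

end Action

/-! ### Generators of `ĨP` sets -/

section Generator

variable {G : Type*} [AddCommGroup G]

theorem ipSum_neg (g : ℕ → G) (α : Finset ℕ) : ipSum (fun k => -g k) α = -ipSum g α :=
  Finset.sum_neg_distrib _

theorem ipSum_sub (g h : ℕ → G) (α : Finset ℕ) :
    ipSum (fun k => g k - h k) α = ipSum g α - ipSum h α :=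
  Finset.sum_sub_distrib _ _

theorem IPTendstoInfty.neg {x : Finset ℕ → G} (hx : IPTendstoInfty x) :
    IPTendstoInfty fun α => -x α := by
  classical
  intro K
  obtain ⟨α₀, h0, h⟩ := hx (K.image fun c => -c)
  refine ⟨α₀, h0, fun α hα hb hmem => h α hα hb (Finset.mem_image.2 ⟨_, hmem, neg_neg _⟩)⟩

theorem IsIPTildeGenerator.neg {d : ℕ} {g : Fin d → ℕ → G} (hg : IsIPTildeGenerator g) :
    IsIPTildeGenerator fun j k => -g j k := by
  refine ⟨fun j => ?_, fun i j hij => ?_⟩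
  · simpa only [← funext (ipSum_neg (g j))] using (hg.1 j).neg
  · have := (hg.2 i j hij).neg
    simpa only [ipSum_neg, neg_sub, sub_neg_eq_add, neg_add_eq_sub] using this

theorem isRingBase_Ico {n i j : ℕ} (hij : i < j) (hj : j ≤ n) :
    IsRingBase fun k => Finset.Ico (n * k + i) (n * k + j) := by
  refine ⟨fun k => Finset.nonempty_Ico.2 (by omega), fun k x hx y hy => ?_⟩
  rw [Finset.mem_Ico] at hx hy
  rw [mul_add] at hy
  omega

/-- Every IP-system tending to infinity contains the first coordinate of an `ĨP` set of any
dimension. -/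
theorem exists_isIPTildeGenerator {g : ℕ → G} (hg : IPTendstoInfty (ipSum g)) (n : ℕ) :
    ∃ h : Fin (n + 1) → ℕ → G, IsIPTildeGenerator h ∧
      ∀ α : Finset ℕ, α.Nonempty → ∃ β : Finset ℕ, β.Nonempty ∧ ipSum (h 0) α = ipSum g β := by
  -- Cut ℕ into blocks of length n + 1 and let h_j sum the first j + 1 terms of each block.
  -- Differences are then sums over non-empty sub-blocks, hence again sub-IP-systems of g up to
  -- sign.
  let a : ℕ → ℕ → ℕ → Finset ℕ := fun i j k => Finset.Ico ((n + 1) * k + i) ((n + 1) * k + j)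
  let h : Fin (n + 1) → ℕ → G := fun j k => ipSum g (a 0 (j + 1) k)
  have hdiff : ∀ i j : Fin (n + 1), i < j →
      IPTendstoInfty fun α => ipSum (h j) α - ipSum (h i) α := by
    intro i j hij
    have hb : IsRingBase (a (i + 1) (j + 1)) :=
      isRingBase_Ico (Nat.succ_lt_succ hij) (Nat.succ_le_of_lt j.2)
    have key := hb.ipTendstoInfty hg
    have e : (fun k => ipSum g (a (i + 1) (j + 1) k)) = fun k => h j k - h i k := by
      funext k
      rw [eq_sub_iff_add_eq']
      refine Finset.sum_Ico_consecutive g (by omega) ?_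
      have : (i : ℕ) < j := hij
      omega
    rw [e, funext (ipSum_sub _ _)] at key
    exact key
  have hbase : ∀ j : Fin (n + 1), IsRingBase (a 0 (j + 1)) := fun j =>
    isRingBase_Ico (Nat.succ_pos j) (Nat.succ_le_of_lt j.2)
  refine ⟨h, ⟨fun j => (hbase j).ipTendstoInfty hg, fun i j hij => ?_⟩, fun α hα => ?_⟩
  · rcases lt_or_gt_of_ne hij with hlt | hlt
    · exact hdiff i j hlt
    · simpa only [neg_sub] using (hdiff j i hlt).neg
  · exact ⟨_, (hbase 0).biUnion_nonempty hα, ((hbase 0).ipSum_biUnion g α).symm⟩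

theorem sum_orderEmbOfFin {M : Type*} [AddCommMonoid M] {m : ℕ} (α : MSubsets m) (u : ℕ → M) :
    ∑ t : Fin m, u (α.1.orderEmbOfFin α.2 t) = ∑ k ∈ α.1, u k := by
  conv_rhs => rw [← Finset.map_orderEmbOfFin_univ α.1 α.2, Finset.sum_map]
  rfl

/-- Repeating one coordinate `m` times along an IP-ring yields sums from the original
IP-system. -/
theorem IsRingBase.sigmaSum_eq {a : ℕ → Finset ℕ} (ha : IsRingBase a) (g : ℕ → G) {m : ℕ}
    (α : MSubsets m) :
    sigmaSum (fun k (_ : Fin m) => ipSum g (a k)) α = ipSum g (α.1.biUnion a) := by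
  rw [ha.ipSum_biUnion]
  exact sum_orderEmbOfFin α fun k => ipSum g (a k)

end Generator

/-! ### Recurrent mixing as the bridge between the statements -/

section Action

variable {G : Type*} [AddCommGroup G] {X : Type*} [MeasurableSpace X] [AddAction G X]

/-- Every IP-system tending to infinity contains times of approximate independence for any two
measurable sets. -/
def IsIPRecurrentlyMixing (μ : Measure X) (G : Type*) [AddCommGroup G] [AddAction G X] : Prop :=
  ∀ g : ℕ → G, IPTendstoInfty (ipSum g) → ∀ A₀ A₁ : Set X, MeasurableSet A₀ → MeasurableSet A₁ →
    ∀ ε > 0, ∃ α : Finset ℕ, α.Nonempty ∧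
      |μ.real (A₀ ∩ (fun x => ipSum g α +ᵥ x) ⁻¹' A₁) - μ.real A₀ * μ.real A₁| < ε

variable [MeasurableConstVAdd G X] {μ : Measure X} [IsProbabilityMeasure μ]
  [VAddInvariantMeasure G X μ]

omit [VAddInvariantMeasure G X μ] in
theorem IsMildlyMixing.isIPRecurrentlyMixing (hM : IsMildlyMixing G μ) :
    IsIPRecurrentlyMixing μ G := by
  intro g hg A₀ A₁ h₀ h₁ ε hε
  obtain ⟨p, hp⟩ := exists_isUnionIdempotent
  have h := hM.tendsto_integral_mul hp hg (.indicator h₁) (.indicator h₀)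
  obtain ⟨α, hα, hα'⟩ := ((hp.tail 0).and (Metric.tendsto_nhds.1 h ε hε)).exists
  refine ⟨α, hα.1, ?_⟩
  have hpre : MeasurableSet ((fun x => ipSum g α +ᵥ x) ⁻¹' A₁) :=
    measurable_const_vadd (ipSum g α) h₁
  have e : ∀ x, A₁.indicator (fun _ => (1 : ℝ)) (ipSum g α +ᵥ x) * A₀.indicator (fun _ => 1) x =
      (A₀ ∩ (fun x => ipSum g α +ᵥ x) ⁻¹' A₁).indicator 1 x := by
    intro x
    rw [Set.inter_indicator_one, Pi.mul_apply, mul_comm]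
    rfl
  simp_rw [e] at hα'
  rw [integral_indicator_one (h₀.inter hpre)] at hα'
  have e0 : ∀ {A : Set X}, MeasurableSet A → ∫ x, A.indicator (fun _ => (1 : ℝ)) x ∂μ = μ.real A :=
    fun hA => integral_indicator_one hA
  rwa [e0 h₀, e0 h₁, mul_comm, Real.dist_eq] at hα'

/-- Pairwise mixing holds simultaneously for countably many IP-systems along one IP-ring. -/
theorem IsIPRecurrentlyMixing.exists_ring [IsSeparable μ] (h : IsIPRecurrentlyMixing μ G)
    {ι : Type*} [Countable ι] {g : ι → ℕ → G} (hg : ∀ i, IPTendstoInfty (ipSum (g i))) :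
    ∃ a, IsRingBase a ∧ ∀ i, ∀ A₀ A₁ : Set X, MeasurableSet A₀ → MeasurableSet A₁ →
      Tendsto (fun α => μ.real (A₀ ∩ (fun x => ipSum (g i) α +ᵥ x) ⁻¹' A₁)) (ringFilter a)
        (𝓝 (μ.real A₀ * μ.real A₁)) := by
  -- Separability leaves only countably many limits to secure, so one ring serves all pairs of sets.
  obtain ⟨𝒜, h𝒜c, h𝒜⟩ := exists_countable_measureDense μ
  have := h𝒜c.to_subtype
  obtain ⟨p, hp⟩ := exists_isUnionIdempotent
  let corr : 𝒜 × 𝒜 → G → ℝ := fun B c => μ.real ((B.1 : Set X) ∩ (fun x => c +ᵥ x) ⁻¹' B.2)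
  obtain ⟨a, ha, hlim⟩ := hp.exists_ring (ι := ι × 𝒜 × 𝒜)
    (x := fun q α => corr q.2 (ipSum (g q.1) α))
    (y := fun q => μ.real (q.2.1 : Set X) * μ.real (q.2.2 : Set X)) fun ⟨i, B⟩ =>
      hp.tendsto_of_forall_exists (φ := corr B)
        (fun g hg ε hε => h g hg _ _ (h𝒜.measurable _ B.1.2) (h𝒜.measurable _ B.2.2) ε hε) (hg i)
  refine ⟨a, ha, fun i A₀ A₁ h₀ h₁ => ?_⟩
  have hdense : ∀ B : Fin (1 + 1) → 𝒜, Tendsto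
      (fun α => multiCorr μ (fun j => (B j : Set X)) fun _ : Fin 1 => -ipSum (g i) α)
      (ringFilter a) (𝓝 (∏ j, μ.real (B j : Set X))) := by
    intro B
    rw [Fin.prod_univ_two fun j => μ.real (B j : Set X)]
    exact (hlim (i, B 0, B 1)).congr fun α => (multiCorr_one (fun j => (B j : Set X)) _).symm
  have hA : ∀ j, MeasurableSet ((![A₀, A₁] : Fin 2 → Set X) j) := by
    intro j
    fin_cases j <;> assumption
  have key := tendsto_multiCorr_of_measureDense (ℓ := 1) h𝒜 hdense (A := ![A₀, A₁]) hA
  rw [Fin.prod_univ_two fun j => μ.real ((![A₀, A₁] : Fin 2 → Set X) j)] at key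
  exact key.congr fun α => multiCorr_one _ _

/-- `exists_ring` turns single good times into convergence along one ring for all sets; linearity
and density carry this to L². -/
theorem IsIPRecurrentlyMixing.isMildlyMixing [IsSeparable μ] (h : IsIPRecurrentlyMixing μ G) :
    IsMildlyMixing G μ := by
  intro g hg
  obtain ⟨a, ha, hlim⟩ := h.exists_ring (ι := Unit) (g := fun _ => g) fun _ => hg
  exact ⟨ringOf a, ha.isIPRing, fun f hf k hk =>
    ha.ipLim_iff.2 (tendsto_integral_mul_conj (hlim ()) hf hk)⟩

/-- Along some IP-ring all sequences `g^{(j)}` and their differences are mixing, and repeating them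
gives sequences in `G^m` inside the given `ĨP` set. -/
theorem IsIPRecurrentlyMixing.exists_mixing_sequences [IsSeparable μ]
    (h : IsIPRecurrentlyMixing μ G) {ℓ : ℕ} {E : Set (Fin ℓ → G)} (hE : IsIPTilde E) {m : ℕ}
    (hm : 1 ≤ m) :
    ∃ g : Fin ℓ → ℕ → Fin m → G,
      (∀ j, NonDegenerated (g j)) ∧
      (∀ i j, i ≠ j → EssentiallyDistinct (g j) (g i)) ∧
      (∀ α : MSubsets m, (fun j => sigmaSum (g j) α) ∈ E) ∧
      (∀ (t : Fin m) (j : Fin ℓ), HasMixingProperty (fun k (x : X) => g j k t +ᵥ x) μ) ∧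
      (∀ (t : Fin m) (i j : Fin ℓ), i ≠ j →
        HasMixingProperty (fun k (x : X) => (g j k t - g i k t) +ᵥ x) μ) := by
  obtain ⟨g, hg, rfl⟩ := hE
  have hsub : ∀ i j, i ≠ j → IPTendstoInfty (ipSum fun k => g j k - g i k) := fun i j hij => by
    simpa only [← funext (ipSum_sub (g j) (g i))] using hg.2 i j hij
  obtain ⟨a, ha, hlim⟩ := h.exists_ring
    (ι := Fin ℓ ⊕ {q : Fin ℓ × Fin ℓ // q.1 ≠ q.2})
    (g := Sum.elim g fun q k => g q.1.2 k - g q.1.1 k)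
    (by
      rintro (j | q)
      exacts [hg.1 j, hsub _ _ q.2])
  -- With m equal coordinates, g_α is the IP-sum over the union of the a_k, k ∈ α, hence stays in E;
  -- m ≥ 1 makes that union non-empty.
  refine ⟨fun j k _ => ipSum (g j) (a k), fun j t => ha.tendsto_cofinite (hg.1 j),
    fun i j hij t => ?_, fun α => ⟨α.1.biUnion a, ha.biUnion_nonempty ?_, ?_⟩,
    fun t j A₀ A₁ h₀ h₁ => ?_, fun t i j hij A₀ A₁ h₀ h₁ => ?_⟩
  · simpa only [ipSum_sub] using ha.tendsto_cofinite (hsub i j hij)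
  · rw [← Finset.card_pos, α.2]
    exact hm
  · funext j
    exact ha.sigmaSum_eq (g j) α
  · exact (hlim (.inl j) A₀ A₁ h₀ h₁).comp (tendsto_ringFilter a)
  · have := (hlim (.inr ⟨(i, j), hij⟩) A₀ A₁ h₀ h₁).comp (tendsto_ringFilter a)
    simpa only [Sum.elim_inr, ipSum_sub, Function.comp_def] using this

/-- A mildly mixing action is multiply mixing along IP-rings. -/
theorem IsMildlyMixing.exists_ring_multiCorr [IsSeparable μ] (hM : IsMildlyMixing G μ) {ℓ : ℕ}
    {g : Fin ℓ → ℕ → G} (hg : IsIPTildeGenerator g) :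
    ∃ a, IsRingBase a ∧ ∀ A : Fin (ℓ + 1) → Set X, (∀ j, MeasurableSet (A j)) →
      Tendsto (fun α => multiCorr μ A fun j => ipSum (g j) α) (ringFilter a)
        (𝓝 (∏ j, μ.real (A j))) := by
  obtain ⟨𝒜, h𝒜c, h𝒜⟩ := exists_countable_measureDense μ
  have := h𝒜c.to_subtype
  obtain ⟨p, hp⟩ := exists_isUnionIdempotent
  have e0 : ∀ {A : Set X}, MeasurableSet A → ∫ x, A.indicator (fun _ => (1 : ℝ)) x ∂μ = μ.real A :=
    fun hA => integral_indicator_one hA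
  obtain ⟨a, ha, hlim⟩ := hp.exists_ring (ι := Fin (ℓ + 1) → 𝒜)
    (x := fun B α => multiCorr μ (fun j => (B j : Set X)) fun j => ipSum (g j) α)
    (y := fun B => ∏ j, μ.real (B j : Set X)) fun B => by
      have hB : ∀ j, MeasurableSet (B j : Set X) := fun j => h𝒜.measurable _ (B j).2
      -- The indicator of T_g A is that of A composed with T_{-g}, hence the negated generators.
      have key := hM.isMultiplyMixing hp ℓ _ hg.neg _ (.indicator (hB 0))
        (fun j => (B j.succ : Set X).indicator fun _ => 1) fun j => .indicator (hB j.succ)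
      simp only [e0 (hB _), ipSum_neg, ← multiCorr_eq_integral hB] at key
      rwa [Fin.prod_univ_succ]
  exact ⟨a, ha, fun A hA => tendsto_multiCorr_of_measureDense h𝒜 hlim hA⟩

omit [MeasurableConstVAdd G X] [IsProbabilityMeasure μ] [VAddInvariantMeasure G X μ] in
/-- An IP-ring of multiple mixing yields an `𝓡`-limit with `m = 1`. -/
theorem exists_rLim_of_ring {ℓ : ℕ} {g : Fin ℓ → ℕ → G} (hg : IsIPTildeGenerator g)
    {a : ℕ → Finset ℕ} (ha : IsRingBase a)
    (hlim : ∀ A : Fin (ℓ + 1) → Set X, (∀ j, MeasurableSet (A j)) →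
      Tendsto (fun α => multiCorr μ A fun j => ipSum (g j) α) (ringFilter a)
        (𝓝 (∏ j, μ.real (A j)))) :
    ∃ h : Fin ℓ → ℕ → Fin 1 → G,
      (∀ j, NonDegenerated (h j)) ∧
      (∀ i j, i ≠ j → EssentiallyDistinct (h j) (h i)) ∧
      (∀ α : MSubsets 1, ∃ β : Finset ℕ, β.Nonempty ∧
        (fun j => sigmaSum (h j) α) = fun j => ipSum (g j) β) ∧
      ∀ A : Fin (ℓ + 1) → Set X, (∀ j, MeasurableSet (A j)) →
        RLim Set.univ (fun α : MSubsets 1 => multiCorr μ A (fun j => sigmaSum (h j) α))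
          (∏ j, μ.real (A j)) := by
  refine ⟨fun j k _ => ipSum (g j) (a k), fun j t => ha.tendsto_cofinite (hg.1 j),
    fun i j hij t => ?_, fun α => ⟨α.1.biUnion a, ha.biUnion_nonempty ?_, ?_⟩, fun A hA ε hε => ?_⟩
  · have hsub : IPTendstoInfty (ipSum fun k => g j k - g i k) := by
      simpa only [← funext (ipSum_sub (g j) (g i))] using hg.2 i j hij
    simpa only [ipSum_sub] using ha.tendsto_cofinite hsub
  · rw [← Finset.card_pos, α.2]
    exact one_pos
  · funext j
    exact ha.sigmaSum_eq (g j) α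
  · have hev := Metric.tendsto_nhds.1 ((hlim A hA).comp (tendsto_ringFilter a)) ε hε
    obtain ⟨K, hK⟩ := eventually_atTop.1 hev
    refine ⟨⟨{K}, Finset.card_singleton K⟩, fun α _ hb => ?_⟩
    obtain ⟨k, hk⟩ := Finset.card_eq_one.1 α.2
    simp only [ha.sigmaSum_eq, hk, Finset.singleton_biUnion]
    exact hK k (hb K (Finset.mem_singleton_self K) k (by rw [hk]; exact Finset.mem_singleton_self k)).le

omit [MeasurableConstVAdd G X] [VAddInvariantMeasure G X μ] in
-- Taking A₂ = ⋯ = A_ℓ = X leaves only the first coordinate, which is arranged to lie in the negated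
-- IP-system.
theorem isIPRecurrentlyMixing_of_returnSet {n : ℕ}
    (h : ∀ A : Fin (n + 1 + 1) → Set X, (∀ j, MeasurableSet (A j)) → ∀ ε : ℝ, 0 < ε →
      IsIPTildeStar (returnSet G μ ε A)) : IsIPRecurrentlyMixing μ G := by
  intro g hg A₀ A₁ h₀ h₁ ε hε
  have hneg : IPTendstoInfty (ipSum fun k => -g k) := by
    simpa only [← funext (ipSum_neg g)] using hg.neg
  obtain ⟨u, hu, hsub⟩ := exists_isIPTildeGenerator hneg n
  let A : Fin (n + 1 + 1) → Set X := Fin.cons A₀ (Fin.cons A₁ fun _ => Set.univ)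
  have hA : ∀ j, MeasurableSet (A j) :=
    Fin.cases h₀ (Fin.cases h₁ fun _ => MeasurableSet.univ)
  obtain ⟨v, hv, α, hα, rfl⟩ := h A hA ε hε _ ⟨u, hu, rfl⟩
  obtain ⟨β, hβ, e⟩ := hsub α hα
  refine ⟨β, hβ, ?_⟩
  have hcorr : multiCorr μ A (fun j => ipSum (u j) α) =
      μ.real (A₀ ∩ (fun x => ipSum g β +ᵥ x) ⁻¹' A₁) := by
    rw [preimage_vadd_eq_neg_vadd, ← ipSum_neg, ← e, multiCorr]
    congr 2
    ext x
    simp [A, Fin.forall_fin_succ]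
  have hprod : ∏ j, μ.real (A j) = μ.real A₀ * μ.real A₁ := by
    simp [A, Fin.prod_univ_succ]
  rw [← hcorr, ← hprod]
  exact hv

omit [MeasurableConstVAdd G X] [IsProbabilityMeasure μ] [VAddInvariantMeasure G X μ] in
-- For m = 1 the sums g_α are the terms of the sequence themselves, so a mixing first coordinate
-- consists of values of the given IP-system.
theorem isIPRecurrentlyMixing_of_mixing_sequences {n : ℕ}
    (h : ∀ E : Set (Fin (n + 1) → G), IsIPTilde E → ∃ g : Fin (n + 1) → ℕ → Fin 1 → G,
      (∀ α : MSubsets 1, (fun j => sigmaSum (g j) α) ∈ E) ∧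
      HasMixingProperty (fun k (x : X) => g 0 k 0 +ᵥ x) μ) : IsIPRecurrentlyMixing μ G := by
  intro g hg A₀ A₁ h₀ h₁ ε hε
  obtain ⟨u, hu, hsub⟩ := exists_isIPTildeGenerator hg n
  obtain ⟨w, hw, hmix⟩ := h _ ⟨u, hu, rfl⟩
  obtain ⟨k, hk⟩ := (Metric.tendsto_nhds.1 (hmix A₀ A₁ h₀ h₁) ε hε).exists
  obtain ⟨α, hα, e⟩ := hw ⟨{k}, Finset.card_singleton k⟩
  obtain ⟨β, hβ, e'⟩ := hsub α hα
  have e0 : w 0 k 0 = ipSum g β := by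
    rw [← e', ← congrFun e 0]
    simp [sigmaSum]
  refine ⟨β, hβ, ?_⟩
  rw [← e0]
  exact hk

end Action

end MildMixing

/-! ### The equivalence of the five statements -/

open MildMixing in
theorem theorem6p1
    {G : Type*} [AddCommGroup G] [Countable G]
    {X : Type*} [MeasurableSpace X] [AddAction G X] [MeasurableConstVAdd G X]
    (μ : Measure X) [IsProbabilityMeasure μ] [MeasureTheory.IsSeparable μ]
    [VAddInvariantMeasure G X μ]
    (ℓ : ℕ) (hℓ : 1 ≤ ℓ) :
    List.TFAE [
      -- (i)
      IsMildlyMixing G μ,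
      -- (ii)
      ∀ E : Set (Fin ℓ → G), IsIPTilde E → ∀ m : ℕ, 1 ≤ m →
        ∃ g : Fin ℓ → ℕ → Fin m → G,
          (∀ j, NonDegenerated (g j)) ∧
          (∀ i j, i ≠ j → EssentiallyDistinct (g j) (g i)) ∧
          (∀ α : MSubsets m, (fun j => sigmaSum (g j) α) ∈ E) ∧
          (∀ (t : Fin m) (j : Fin ℓ), HasMixingProperty (fun k (x : X) => g j k t +ᵥ x) μ) ∧
          (∀ (t : Fin m) (i j : Fin ℓ), i ≠ j →
            HasMixingProperty (fun k (x : X) => (g j k t - g i k t) +ᵥ x) μ),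
      -- (iii)
      ∀ E : Set (Fin ℓ → G), IsIPTilde E →
        ∃ m : ℕ, 1 ≤ m ∧ ∃ g : Fin ℓ → ℕ → Fin m → G,
          (∀ j, NonDegenerated (g j)) ∧
          (∀ i j, i ≠ j → EssentiallyDistinct (g j) (g i)) ∧
          (∀ α : MSubsets m, (fun j => sigmaSum (g j) α) ∈ E) ∧
          ∀ A : Fin (ℓ + 1) → Set X, (∀ j, MeasurableSet (A j)) →
            RLim Set.univ (fun α : MSubsets m => multiCorr μ A (fun j => sigmaSum (g j) α))
              (∏ j, μ.real (A j)),
      -- (iv)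
      ∀ g : Fin ℓ → ℕ → G, IsIPTildeGenerator g →
        ∃ R : Set (Finset ℕ), IsIPRing R ∧
          ∀ A : Fin (ℓ + 1) → Set X, (∀ j, MeasurableSet (A j)) →
            IPLim R (fun α => multiCorr μ A (fun j => ipSum (g j) α)) (∏ j, μ.real (A j)),
      -- (v)
      ∀ A : Fin (ℓ + 1) → Set X, (∀ j, MeasurableSet (A j)) → ∀ ε : ℝ, 0 < ε →
        IsIPTildeStar (returnSet G μ ε A)] := by
  -- The implications back to (i) need a first coordinate.
  obtain ⟨n, rfl⟩ : ∃ n, ℓ = n + 1 := ⟨ℓ - 1, by omega⟩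
  tfae_have 1 → 2 := fun hM E hE m hm =>
    hM.isIPRecurrentlyMixing.exists_mixing_sequences hE hm
  tfae_have 2 → 1 := fun h => by
    refine (isIPRecurrentlyMixing_of_mixing_sequences (n := n) fun E hE => ?_).isMildlyMixing
    obtain ⟨g, -, -, hgE, hmix, -⟩ := h E hE 1 le_rfl
    exact ⟨g, hgE, hmix 0 0⟩
  tfae_have 1 → 4 := fun hM g hg => by
    obtain ⟨a, ha, hlim⟩ := hM.exists_ring_multiCorr hg
    exact ⟨ringOf a, ha.isIPRing, fun A hA => ha.ipLim_iff.2 (hlim A hA)⟩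
  tfae_have 4 → 3 := fun h E hE => by
    obtain ⟨g, hg, rfl⟩ := hE
    obtain ⟨R, hR, hlim⟩ := h g hg
    obtain ⟨a, ha, rfl⟩ := hR.exists_base
    exact ⟨1, le_rfl, exists_rLim_of_ring hg ha fun A hA => ha.ipLim_iff.1 (hlim A hA)⟩
  tfae_have 3 → 5 := fun h A hA ε hε E hE => by
    obtain ⟨m, -, g, -, -, hgE, hlim⟩ := h E hE
    obtain ⟨α₀, hα₀⟩ := hlim A hA ε hε
    -- Any m-element set beyond α₀ will do; this is the interval of length m just after its maximum.
    let α : MSubsets m := ⟨Finset.Ico (α₀.1.sup id + 1) (α₀.1.sup id + 1 + m), by simp⟩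
    refine ⟨_, hα₀ α (Set.subset_univ _) fun x hx y hy => ?_, hgE α⟩
    exact Nat.lt_of_succ_le
      ((Nat.succ_le_succ (Finset.le_sup (f := id) hx)).trans (Finset.mem_Ico.1 hy).1)
  tfae_have 5 → 1 := fun h => (isIPRecurrentlyMixing_of_returnSet h).isMildlyMixing
  tfae_finish
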